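/- Let $\mathcal N$ be a finite non-empty set of operators, $\alpha>2$, $W\ge 0$, $\theta\ge 0$, and $\lambda_i>0$ for $i\in\mathcal N$. Let the transmitters of operator $i\in\mathcal N$ form a homogeneous Poisson point process (PPP) $\Phi_i\subset\mathbb R^2$ with intensity $\lambda_i$, the processes $\Phi_i$, $i\in\mathcal N$, being independent, and let $\Phi=\bigcup_{i\in\mathcal N}\Phi_i$. A reference user of operator $n\in\mathcal N$ is located at a fixed point $y_n\in\mathbb R^2$. Each operator holds one spectrum band, and the bands are indexed by $k\in\mathcal N$. The power fading $h_z$ between a transmitter $z\in\Phi$ and the user is exponentially distributed with unit mean, independent over the transmitters, independent of their locations, and the same in all bands (flat fading); the path loss is $l(z)=\|z-y_n\|^{-\alpha}$. In the full sharing scenario the user is served by the transmitter $x\in\Phi$ nearest to $y_n$, and its signal-to-interference-and-noise ratio in every band $k\in\mathcal N$ is $$\mathrm{SINR}_k=\frac{h_x\,l(x)}{|\mathcal N|\,W+\sum_{z\in\Phi\setminus\{x\}}h_z\,l(z)} .$$ Then $\Phi$ is a PPP with intensity $\sum_{i\in\mathcal N}\lambda_i$, almost surely there is exactly one nearest transmitter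 $x$, and the coverage probability $p_n(\theta)=\mathbb P\big(\bigcap_{k\in\mathcal N}\{\mathrm{SINR}_k>\theta\}\big)$, which equals $\mathbb P(\mathrm{SINR}_k>\theta)$ for each $k\in\mathcal N$, is $$p_n(\theta)=\pi\Big(\sum_{i\in\mathcal N}\lambda_i\Big)\int_0^\infty \exp\big(-\theta r^{\alpha/2}|\mathcal N|W\big)\exp\Big(-\pi r\big(1+\mathfrak Z(\theta,\alpha)\big)\sum_{j\in\mathcal N}\lambda_j\Big)\,dr ,$$ where $\mathfrak Z(\theta,\alpha)=\frac{2\theta}{\alpha-2}\,{}_2F_1\big(1,1-\tfrac2\alpha;2-\tfrac2\alpha;-\theta\big)$ and ${}_2F_1$ is the Gauss hypergeometric function (analytically continued to $(-\infty,1)$). That is, $p_n(\theta)$ is the value that the same formula takes for a single operator with intensity $\sum_{i}\lambda_i$ and noise power $|\mathcal N|W$. -/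

import Mathlib

open MeasureTheory ProbabilityTheory Set Filter Topology
open scoped ENNReal NNReal

/-- The Euclidean plane. -/
abbrev Plane : Type := EuclideanSpace ℝ (Fin 2)

/-! ## The Gauss hypergeometric function on the half-line `z < 1` -/

/-- `F` is the real-analytic continuation to `(-∞, 1)` of the Gauss hypergeometric series
`∑ (a)ₘ (b)ₘ / (c)ₘ * z ^ m / m!`, which converges only for `|z| < 1`. -/
def IsHypergeometricContinuation (a b c : ℝ) (F : ℝ → ℝ) : Prop :=
  AnalyticOnNhd ℝ F (Iio 1) ∧ ∀ z ∈ Ioo (-1 : ℝ) 1, F z = ordinaryHypergeometric a b c z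

/-- The Gauss hypergeometric function `₂F₁(a, b; c; z)` for real `z < 1`: the analytic continuation
of the hypergeometric series.  (Mathlib's `ordinaryHypergeometric` is the sum of the series, which
carries no information for `|z| > 1`.) -/
noncomputable def gaussHypergeometric (a b c : ℝ) : ℝ → ℝ :=
  Classical.epsilon (IsHypergeometricContinuation a b c)

/-- The continuation is unique on `(-∞, 1)`, so `gaussHypergeometric` does not depend on a choice
there. -/
theorem IsHypergeometricContinuation.gaussHypergeometric_eq {a b c : ℝ} {F : ℝ → ℝ}
    (hF : IsHypergeometricContinuation a b c F) {z : ℝ} (hz : z < 1) :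
    gaussHypergeometric a b c z = F z := by
  have hG : IsHypergeometricContinuation a b c (gaussHypergeometric a b c) :=
    Classical.epsilon_spec (p := IsHypergeometricContinuation a b c) ⟨F, hF⟩
  have hmem : Ioo (-1 : ℝ) 1 ∈ 𝓝 (0 : ℝ) := Ioo_mem_nhds (by norm_num) (by norm_num)
  refine hG.1.eqOn_of_preconnected_of_eventuallyEq hF.1 isPreconnected_Iio
    (show (0 : ℝ) ∈ Iio 1 by simp) ?_ hz
  filter_upwards [hmem] with x hx
  rw [hG.2 x hx, hF.2 x hx]

/-- `𝔷(θ, α) = 2θ / (α - 2) * ₂F₁(1, 1 - 2/α; 2 - 2/α; -θ)`. -/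
noncomputable def interferenceFactor (θ α : ℝ) : ℝ :=
  2 * θ / (α - 2) * gaussHypergeometric 1 (1 - 2 / α) (2 - 2 / α) (-θ)

/-! ## Poisson point processes in the plane -/

section PointProcess

variable {Ω : Type*} [MeasurableSpace Ω]

/-- The number of points of the random set `Φ` in `B`. -/
noncomputable def pointCount (Φ : Ω → Set Plane) (B : Set Plane) (ω : Ω) : ℕ∞ :=
  (Φ ω ∩ B).encard

/-- The σ-algebra generated by a random set of points, i.e. by its counting variables. -/
noncomputable abbrev pointSigmaAlgebra (Φ : Ω → Set Plane) : MeasurableSpace Ω :=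
  ⨆ (B : Set Plane) (_ : MeasurableSet B), MeasurableSpace.comap (pointCount Φ B) ⊤

/-- `Φ` is a homogeneous Poisson point process in the plane with intensity `lam` (a random, almost
surely locally finite set of points whose numbers in bounded Borel sets `B` are Poisson with mean
`lam * |B|`, and independent for disjoint sets). -/
structure IsPoissonPointProcess (P : Measure Ω) (Φ : Ω → Set Plane) (lam : ℝ) : Prop where
  locallyFinite : ∀ᵐ ω ∂P, ∀ B : Set Plane, Bornology.IsBounded B → (Φ ω ∩ B).Finite
  measurable_count : ∀ B : Set Plane, MeasurableSet B →
    ∀ m : ℕ∞, MeasurableSet {ω | pointCount Φ B ω = m}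
  poisson_count : ∀ B : Set Plane, MeasurableSet B → Bornology.IsBounded B → ∀ m : ℕ,
    P {ω | pointCount Φ B ω = m} = poissonMeasure (lam * volume.real B).toNNReal {m}
  independent_counts : ∀ (m : ℕ) (B : Fin m → Set Plane),
    (∀ j, MeasurableSet (B j)) → (∀ j, Bornology.IsBounded (B j)) →
    Pairwise (fun i j => Disjoint (B i) (B j)) →
    iIndep (fun j => MeasurableSpace.comap (pointCount Φ (B j)) ⊤) P

end PointProcess

/-! ## Reception -/

section Reception

variable {Ω κ : Type*}

/-- The path loss `‖x - y‖ ^ (-α)` between a transmitter at `x` and a user at `y`. -/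
noncomputable def pathLoss (α : ℝ) (y x : Plane) : ℝ := ‖x - y‖ ^ (-α)

/-- Transmitter `p`, among the transmitters at the locations `X q ω`, is a closest one to the user
at `y`. -/
def IsNearest (X : κ → Ω → Plane) (y : Plane) (ω : Ω) (p : κ) : Prop :=
  ∀ q, ‖X p ω - y‖ ≤ ‖X q ω - y‖

/-- The serving transmitter: the argmin of the distance to the user at `y`. -/
noncomputable def serving [Nonempty κ] (X : κ → Ω → Plane) (y : Plane) (ω : Ω) : κ :=
  Classical.epsilon (IsNearest X y ω)

/-- The signal-to-interference-and-noise ratio (an extended nonnegative real) of the user at `y`,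
served by the nearest of the transmitters `X`, in a band with fading variables `h`, noise power `W`
and power-splitting factor `η`; all transmitters but the serving one interfere. -/
noncomputable def sinr [Nonempty κ] (α W η : ℝ) (X : κ → Ω → Plane) (h : κ → Ω → ℝ) (y : Plane)
    (ω : Ω) : ℝ≥0∞ :=
  ENNReal.ofReal (h (serving X y ω) ω * pathLoss α y (X (serving X y ω) ω)) /
    (ENNReal.ofReal (η * W) +
      ∑' p : {p : κ // p ≠ serving X y ω}, ENNReal.ofReal (h p ω * pathLoss α y (X p ω)))

end Reception

/-! Only the squared distances `U p = ‖X p - y‖ ^ 2` matter. Area grows linearly in the squared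
radius, so they behave like a Poisson process on the half-line with rate `c = π ∑ λᵢ`, and the
nearest one has density `c exp (-c u)`.

Fix the locations, with nearest squared distance `u`. Coverage then says that a unit exponential
variable exceeds `θ u ^ (α/2)` times noise plus interference. The exponential tail turns its
probability into a Laplace transform. The noise gives `exp (-θ u ^ (α/2) |N| W)`, and an interferer
at squared distance `v` gives `1 / (1 + θ (u/v) ^ (α/2))` (`measure_coverage_fixed`). Averaging the
product over the points beyond `u` gives `exp (-c ∫_u^∞ θ / (θ + (v/u) ^ (α/2)) dv)`. By scaling,
the integral is `u` times its value at `u = 1`, and this value is `𝔷(θ, α)`: the substitution `v = t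
^ (-2/α)` turns it into Euler's integral, which continues `₂F₁` to the half-line
(`isHypergeometricContinuation_euler_integral`, `integral_Ioi_one_interference`).

The joint law of the nearest point and the points beyond it (`lintegral_nearest`) comes from the
Laplace functional alone (`laplace_functional`). A test function equal to `∞` on `[0, a)` encodes
that no point lies below `a`. Subtracting two such identities locates the nearest point in a dyadic
cell, and the mesh then tends to zero.

Superposition rests on the additivity of independent Poisson variables. That two distances almost
surely differ follows by cutting a disc into thin annuli of equal area (`ae_injective_norm_sub`);
this also makes the operators' point sets disjoint and the nearest transmitter unique. The case `θ =
0` is a limit of positive thresholds. -/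

/-! ## Squared distances in the plane -/

/-- The squared distance to a fixed point pushes Lebesgue measure of the plane forward to `π` times
Lebesgue measure on the half-line. -/
theorem map_sq_dist_volume (y : Plane) :
    (volume : Measure Plane).map (fun x => ‖x - y‖ ^ 2) =
      ENNReal.ofReal Real.pi • volume.restrict (Ici 0) := by
  have hmeas : Measurable (fun x : Plane => ‖x - y‖ ^ 2) := by fun_prop
  have hball : ∀ c : ℝ, 0 ≤ c →
      (fun x : Plane => ‖x - y‖ ^ 2) ⁻¹' Iio c = Metric.ball y (√c) := by
    intro c hc
    ext x
    simp only [mem_preimage, mem_Iio, Metric.mem_ball, dist_eq_norm]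
    exact (Real.lt_sqrt (norm_nonneg _)).symm
  have hvol : ∀ c : ℝ, 0 ≤ c →
      volume ((fun x : Plane => ‖x - y‖ ^ 2) ⁻¹' Iio c) = ENNReal.ofReal (Real.pi * c) := by
    intro c hc
    rw [hball c hc, EuclideanSpace.volume_ball_fin_two, ← ENNReal.ofReal_pow (Real.sqrt_nonneg _),
      Real.sq_sqrt hc, mul_comm Real.pi, ENNReal.ofReal_mul hc]
  -- Truncating the endpoints at zero covers intervals that reach below zero, where the squared
  -- distance takes no values.
  have key : ∀ ⦃a b : ℝ⦄, a < b → (volume : Measure Plane).map (fun x => ‖x - y‖ ^ 2) (Ico a b) =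
      ENNReal.ofReal (Real.pi * (max b 0 - max a 0)) := by
    intro a b hab
    rw [Measure.map_apply hmeas measurableSet_Ico]
    have : (fun x : Plane => ‖x - y‖ ^ 2) ⁻¹' Ico a b =
        ((fun x : Plane => ‖x - y‖ ^ 2) ⁻¹' Iio (max b 0)) \
          ((fun x : Plane => ‖x - y‖ ^ 2) ⁻¹' Iio (max a 0)) := by
      ext x
      have : 0 ≤ ‖x - y‖ ^ 2 := by positivity
      simp only [mem_preimage, mem_Ico, Set.mem_sdiff, mem_Iio, not_or, not_lt, lt_max_iff]
      constructor
      · rintro ⟨h1, h2⟩; exact ⟨Or.inl h2, h1, this⟩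
      · rintro ⟨h1, h2, -⟩; exact ⟨h2, h1.resolve_right (not_lt.2 this)⟩
    rw [this, measure_sdiff (preimage_mono (Iio_subset_Iio (max_le_max hab.le le_rfl)))
      (hmeas measurableSet_Iio).nullMeasurableSet, hvol _ (le_max_right _ _),
      hvol _ (le_max_right _ _), ← ENNReal.ofReal_sub, mul_sub]
    · exact mul_nonneg Real.pi_pos.le (le_max_right _ _)
    · rw [hvol _ (le_max_right _ _)]; exact ENNReal.ofReal_ne_top
  refine Measure.ext_of_Ico' _ _ (fun a b hab => ?_) (fun a b hab => ?_)
  · rw [key hab]; exact ENNReal.ofReal_ne_top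
  · rw [key hab, Measure.smul_apply, Measure.restrict_apply measurableSet_Ico, smul_eq_mul]
    have : Ico a b ∩ Ici 0 = Ico (max a 0) (max b 0) := by
      ext x
      simp only [mem_inter_iff, mem_Ico, mem_Ici, max_le_iff, lt_max_iff]
      constructor
      · rintro ⟨⟨h1, h2⟩, h3⟩; exact ⟨⟨h1, h3⟩, Or.inl h2⟩
      · rintro ⟨⟨h1, h2⟩, h3⟩; exact ⟨⟨h1, h3.resolve_right (not_lt.2 h2)⟩, h2⟩
    rw [this, Real.volume_Ico, ENNReal.ofReal_mul Real.pi_pos.le]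

theorem volume_real_annulus (y : Plane) {a b : ℝ} (ha : 0 ≤ a) (hab : a ≤ b) :
    volume.real ((fun x : Plane => ‖x - y‖ ^ 2) ⁻¹' Ico a b) = Real.pi * (b - a) := by
  have hmeas : Measurable (fun x : Plane => ‖x - y‖ ^ 2) := by fun_prop
  rw [measureReal_def, ← Measure.map_apply hmeas measurableSet_Ico, map_sq_dist_volume,
    Measure.smul_apply, Measure.restrict_apply measurableSet_Ico, smul_eq_mul,
    inter_eq_left.2 (show Ico a b ⊆ Ici 0 from fun x hx => ha.trans hx.1), Real.volume_Ico, ENNReal.toReal_mul,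
    ENNReal.toReal_ofReal Real.pi_pos.le, ENNReal.toReal_ofReal (by linarith)]

theorem isBounded_annulus (y : Plane) (a b : ℝ) :
    Bornology.IsBounded ((fun x : Plane => ‖x - y‖ ^ 2) ⁻¹' Ico a b) := by
  refine (Metric.isBounded_ball (x := y) (r := √b)).subset fun x hx => ?_
  rw [Metric.mem_ball, dist_eq_norm]
  exact (Real.lt_sqrt (norm_nonneg _)).2 hx.2

/-! ## Superposition of independent Poisson processes -/

theorem iUnion_eq_range {Ω N : Type*} {Φ : N → Ω → Set Plane} {X : N × ℕ → Ω → Plane}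
    (hX : ∀ i ω, Φ i ω = range (fun j : ℕ => X (i, j) ω)) (ω : Ω) :
    ⋃ i, Φ i ω = range (fun p => X p ω) := by
  ext x
  simp [hX]

/-- The number of points of all the processes in `B`, counted with multiplicity. -/
noncomputable def totalCount {Ω N : Type*} [Fintype N] (Φ : N → Ω → Set Plane) (B : Set Plane) (ω : Ω) : ℕ∞ :=
  ∑ i, pointCount (Φ i) B ω

/-- Points of different operators are not yet known to be distinct, so a count in the union could
miss a coincidence. In the sum of the counts, two indices always contribute two: two points of one
operator, or one in each of two summands. -/
theorem totalCount_two_le {Ω N : Type*} [Fintype N] {Φ : N → Ω → Set Plane}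
    {X : N × ℕ → Ω → Plane}
    (hX : ∀ i ω, Φ i ω = range (fun j : ℕ => X (i, j) ω)) {ω : Ω}
    (hinj : ∀ i, Function.Injective (fun j : ℕ => X (i, j) ω)) {p q : N × ℕ} (hpq : p ≠ q)
    {B : Set Plane} (hp : X p ω ∈ B) (hq : X q ω ∈ B) : 2 ≤ totalCount Φ B ω := by
  classical
  obtain ⟨i, a⟩ := p
  obtain ⟨j, b⟩ := q
  have hp' : X (i, a) ω ∈ Φ i ω ∩ B := ⟨by rw [hX]; exact mem_range_self a, hp⟩
  have hq' : X (j, b) ω ∈ Φ j ω ∩ B := ⟨by rw [hX]; exact mem_range_self b, hq⟩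
  by_cases hij : i = j
  · subst hij
    have hne : X (i, a) ω ≠ X (i, b) ω := fun h => hpq (by rw [hinj i h])
    calc (2 : ℕ∞) = ({X (i, a) ω, X (i, b) ω} : Set Plane).encard := (encard_pair hne).symm
      _ ≤ pointCount (Φ i) B ω := encard_le_encard (by
          rintro x (rfl | rfl) <;> assumption)
      _ ≤ totalCount Φ B ω := Finset.single_le_sum (f := fun i => pointCount (Φ i) B ω)
          (fun _ _ => zero_le) (Finset.mem_univ i)
  · calc (2 : ℕ∞) = 1 + 1 := by norm_num
      _ ≤ pointCount (Φ i) B ω + pointCount (Φ j) B ω :=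
          add_le_add (one_le_encard_iff_nonempty.2 ⟨_, hp'⟩) (one_le_encard_iff_nonempty.2 ⟨_, hq'⟩)
      _ = ∑ k ∈ {i, j}, pointCount (Φ k) B ω :=
          (Finset.sum_pair (f := fun k => pointCount (Φ k) B ω) hij).symm
      _ ≤ totalCount Φ B ω := Finset.sum_le_sum_of_subset (Finset.subset_univ _)

/-- By local finiteness only finitely many points are at most as far away as a given one, and
injectivity carries this finiteness over to the indices. -/
theorem exists_isNearest {Ω κ : Type*} [Nonempty κ] {X : κ → Ω → Plane} {ω : Ω}
    (hinj : Function.Injective (fun p => X p ω))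
    (hfin : ∀ B : Set Plane, Bornology.IsBounded B → (range (fun p => X p ω) ∩ B).Finite)
    (y : Plane) : ∃ p, IsNearest X y ω p := by
  obtain ⟨p₀⟩ := ‹Nonempty κ›
  let S : Set κ := {p | ‖X p ω - y‖ ≤ ‖X p₀ ω - y‖}
  have hS : S.Finite := by
    refine Finite.of_finite_image ((hfin (Metric.closedBall y ‖X p₀ ω - y‖)
      Metric.isBounded_closedBall).subset ?_) (hinj.injOn (s := S))
    rintro _ ⟨p, hp, rfl⟩
    exact ⟨mem_range_self p, by rw [Metric.mem_closedBall, dist_eq_norm]; exact hp⟩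
  obtain ⟨p, hp, hmin⟩ := exists_min_image S (fun p => ‖X p ω - y‖) hS ⟨p₀, le_refl ‖X p₀ ω - y‖⟩
  refine ⟨p, fun q => ?_⟩
  by_cases hq : q ∈ S
  · exact hmin q hq
  · exact hp.trans (not_le.1 hq).le

section Superposition

variable {Ω : Type*} [MeasurableSpace Ω] {P : Measure Ω}

instance : MeasurableAdd₂ ℕ∞ := ⟨.of_discrete⟩

theorem IsPoissonPointProcess.measurable_pointCount {Φ : Ω → Set Plane} {lam : ℝ}
    (hΦ : IsPoissonPointProcess P Φ lam) {B : Set Plane} (hB : MeasurableSet B) :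
    Measurable (pointCount Φ B) :=
  measurable_to_countable' fun m => hΦ.measurable_count B hB m

/-- The definition prescribes the probabilities of finite counts only; the value `⊤` is null by
local finiteness. -/
theorem IsPoissonPointProcess.hasLaw_pointCount {Φ : Ω → Set Plane}
    {lam : ℝ} (hΦ : IsPoissonPointProcess P Φ lam) {B : Set Plane} (hB : MeasurableSet B)
    (hBb : Bornology.IsBounded B) :
    HasLaw (pointCount Φ B)
      ((poissonMeasure (lam * volume.real B).toNNReal).map (Nat.cast : ℕ → ℕ∞)) P where
  aemeasurable := (hΦ.measurable_pointCount hB).aemeasurable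
  map_eq := by
    refine Measure.ext_of_singleton fun m => ?_
    rw [Measure.map_apply (hΦ.measurable_pointCount hB) (measurableSet_singleton m),
      Measure.map_apply .of_discrete (measurableSet_singleton m)]
    induction m with
    | top =>
      have h0 : (Nat.cast : ℕ → ℕ∞) ⁻¹' {⊤} = ∅ := by ext; simp
      rw [h0, measure_empty]
      refine measure_mono_null ?_ hΦ.locallyFinite
      intro ω hω hfin
      have := (hfin B hBb).encard_lt_top
      exact this.ne hω
    | coe m =>
      have h0 : (Nat.cast : ℕ → ℕ∞) ⁻¹' {(m : ℕ∞)} = {m} := by ext; simp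
      rw [h0, ← hΦ.poisson_count B hB hBb m]
      rfl

/-- The left side is `1 - exp (-r) (1 + r)`, and `exp (-r) ≥ 1 - r` gives `1 - (1 - r) (1 + r) = r ^
2`. The quadratic order is what makes the sum over thin annuli vanish. -/
theorem poissonMeasure_two_le (r : ℝ≥0) :
    (poissonMeasure r).real {m | 2 ≤ m} ≤ (r : ℝ) ^ 2 := by
  have h : {m : ℕ | 2 ≤ m} = ({0} ∪ {1})ᶜ := by ext m; simp; omega
  rw [h, measureReal_compl (.of_discrete), measureReal_union (by simp) (.of_discrete),
    poissonMeasure_real_singleton, poissonMeasure_real_singleton]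
  simp only [probReal_univ, pow_zero, mul_one, Nat.factorial, Nat.cast_one, div_one, pow_one]
  have h1 := Real.add_one_le_exp (-(r : ℝ))
  have h2 : (0 : ℝ) ≤ r := r.2
  norm_num
  nlinarith

/-- A product measure over pairs is a product of product measures, so a jointly independent double
family has independent rows. -/
theorem ProbabilityTheory.iIndepFun.curry {ι κ β : Type*} [MeasurableSpace β] {X : ι → κ → Ω → β}
    (mX : ∀ i j, Measurable (X i j)) (h : iIndepFun (fun (p : ι × κ) => X p.1 p.2) P) :
    iIndepFun (fun i ω j => X i j ω) P := by
  have := h.isProbabilityMeasure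
  have hs : iIndepFun (fun (p : (_ : ι) × κ) ω => X p.1 p.2 ω) P :=
    h.precomp (g := Equiv.sigmaEquivProd ι κ) (Equiv.injective _)
  have hp : ∀ i j, IsProbabilityMeasure (P.map (X i j)) :=
    fun i j => Measure.isProbabilityMeasure_map (mX i j).aemeasurable
  have hi : ∀ i, iIndepFun (X i) P :=
    fun i => h.precomp (g := Prod.mk i) (Prod.mk_right_injective i)
  rw [iIndepFun_iff_map_fun_eq_infinitePi_map (by fun_prop)] at hs ⊢
  have hc : (MeasurableEquiv.piCurry fun (_ : ι) (_ : κ) => β) ∘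
      (fun ω (p : (_ : ι) × κ) => X p.1 p.2 ω) = fun ω i j => X i j ω := by
    ext; simp [Sigma.curry]
  rw [← hc, ← Measure.map_map (by fun_prop) (by fun_prop), hs,
    Measure.infinitePi_map_piCurry (fun i j => P.map (X i j))]
  congr 1
  ext1 i
  rw [← (iIndepFun_iff_map_fun_eq_infinitePi_map (mX i)).1 (hi i)]

variable {N : Type*} {lam : N → ℝ} {Φ : N → Ω → Set Plane}

theorem iIndepFun_pointCount (hindep : iIndep (fun i => pointSigmaAlgebra (Φ i)) P)
    {B : Set Plane} (hB : MeasurableSet B) : iIndepFun (fun i => pointCount (Φ i) B) P :=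
  iIndep_of_iIndep_of_le hindep fun i => le_iSup₂_of_le B hB le_rfl

theorem hasLaw_totalCount [Fintype N] [IsProbabilityMeasure P] (hlam : ∀ i, 0 < lam i)
    (hPoisson : ∀ i, IsPoissonPointProcess P (Φ i) (lam i))
    (hindep : iIndep (fun i => pointSigmaAlgebra (Φ i)) P) {B : Set Plane} (hB : MeasurableSet B)
    (hBb : Bornology.IsBounded B) :
    HasLaw (totalCount Φ B)
      ((poissonMeasure ((∑ i, lam i) * volume.real B).toNNReal).map (Nat.cast : ℕ → ℕ∞)) P := by
  classical
  suffices h : ∀ s : Finset N, HasLaw (fun ω => ∑ i ∈ s, pointCount (Φ i) B ω)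
      ((poissonMeasure ((∑ i ∈ s, lam i) * volume.real B).toNNReal).map (Nat.cast : ℕ → ℕ∞)) P from
    h Finset.univ
  intro s
  induction s using Finset.induction_on with
  | empty =>
    refine ⟨by simp, ?_⟩
    refine Measure.ext_of_singleton fun m => ?_
    simp only [Finset.sum_empty, zero_mul, Real.toNNReal_zero, Measure.map_const, measure_univ,
      one_smul]
    rw [Measure.map_apply .of_discrete (measurableSet_singleton m)]
    induction m with
    | top =>
      have h0 : (Nat.cast : ℕ → ℕ∞) ⁻¹' {⊤} = ∅ := by ext; simp
      rw [h0, measure_empty]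
      simp
    | coe m =>
      have h0 : (Nat.cast : ℕ → ℕ∞) ⁻¹' {(m : ℕ∞)} = {m} := by ext; simp
      rw [h0, poissonMeasure_singleton]
      rcases Nat.eq_zero_or_pos m with rfl | hm
      · simp
      · simp [hm.ne']
  | insert a s ha ih =>
    have hsum : (0 : ℝ) ≤ ∑ i ∈ s, lam i := Finset.sum_nonneg fun i _ => (hlam i).le
    have hind := (iIndepFun_pointCount hindep hB).indepFun_finsetSum_of_notMem
      (fun i => (hPoisson i).measurable_pointCount hB) ha
    have := (hind.symm).hasLaw_add_map_cast_poissonMeasure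
      ((hPoisson a).hasLaw_pointCount hB hBb) (by
        convert ih using 1
        ext ω; simp)
    convert this using 1
    · ext ω; simp [Finset.sum_insert ha]
    · rw [Finset.sum_insert ha, add_mul, Real.toNNReal_add (by have := hlam a; positivity)
        (by positivity)]

/-- The counts indexed by operator and set are jointly independent: across operators by assumption,
across disjoint sets by the Poisson property. Swapping the indices groups them by set, and each
total is a function of one group. -/
theorem iIndepFun_totalCount [Fintype N] (hPoisson : ∀ i, IsPoissonPointProcess P (Φ i) (lam i))
    (hindep : iIndep (fun i => pointSigmaAlgebra (Φ i)) P) {m : ℕ} {B : Fin m → Set Plane}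
    (hB : ∀ j, MeasurableSet (B j)) (hBb : ∀ j, Bornology.IsBounded (B j))
    (hd : Pairwise (fun i j => Disjoint (B i) (B j))) :
    iIndepFun (fun j => totalCount Φ (B j)) P := by
  have hm : ∀ i j, Measurable (pointCount (Φ i) (B j)) :=
    fun i j => (hPoisson i).measurable_pointCount (hB j)
  have h1 : iIndepFun (fun i ω j => pointCount (Φ i) (B j) ω) P := by
    refine iIndep_of_iIndep_of_le hindep fun i => ?_
    refine Measurable.comap_le (@measurable_pi_lambda _ _ _ (pointSigmaAlgebra (Φ i)) _ _ fun j => ?_)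
    exact Measurable.of_comap_le (le_iSup₂_of_le (B j) (hB j) le_rfl)
  have h2 : iIndepFun (fun (p : N × Fin m) ω => pointCount (Φ p.1) (B p.2) ω) P :=
    iIndepFun_uncurry' hm h1 fun i => (hPoisson i).independent_counts m B hB hBb hd
  have h3 : iIndepFun (fun (p : Fin m × N) ω => pointCount (Φ p.2) (B p.1) ω) P :=
    h2.precomp (g := Prod.swap) Prod.swap_injective
  exact (h3.curry fun j i => hm i j).comp (fun _ f => ∑ i, f i) fun _ => by fun_prop

theorem measure_totalCount_two_le [Fintype N] [IsProbabilityMeasure P] (hlam : ∀ i, 0 < lam i)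
    (hPoisson : ∀ i, IsPoissonPointProcess P (Φ i) (lam i))
    (hindep : iIndep (fun i => pointSigmaAlgebra (Φ i)) P) {B : Set Plane} (hB : MeasurableSet B)
    (hBb : Bornology.IsBounded B) :
    P {ω | 2 ≤ totalCount Φ B ω} ≤ ENNReal.ofReal (((∑ i, lam i) * volume.real B) ^ 2) := by
  have h0 : 0 ≤ (∑ i, lam i) * volume.real B :=
    mul_nonneg (Finset.sum_nonneg fun i _ => (hlam i).le) measureReal_nonneg
  rw [(hasLaw_totalCount hlam hPoisson hindep hB hBb).measure_eq (p := fun m => 2 ≤ m) .of_discrete,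
    Measure.map_apply .of_discrete .of_discrete]
  have h1 : (Nat.cast : ℕ → ℕ∞) ⁻¹' {m | 2 ≤ m} = {m | 2 ≤ m} := by
    ext m; simp
  rw [h1, ← ofReal_measureReal]
  refine ENNReal.ofReal_le_ofReal ((poissonMeasure_two_le _).trans_eq ?_)
  rw [Real.coe_toNNReal _ h0]

/-- Almost surely no two transmitters are at the same distance from `y`. -/
theorem ae_injective_norm_sub [Fintype N] [IsProbabilityMeasure P] (hlam : ∀ i, 0 < lam i)
    {X : N × ℕ → Ω → Plane} (hXinj : ∀ i, ∀ᵐ ω ∂P, Function.Injective (fun j : ℕ => X (i, j) ω))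
    (hX : ∀ i ω, Φ i ω = range (fun j : ℕ => X (i, j) ω))
    (hPoisson : ∀ i, IsPoissonPointProcess P (Φ i) (lam i))
    (hindep : iIndep (fun i => pointSigmaAlgebra (Φ i)) P) (y : Plane) :
    ∀ᵐ ω ∂P, Function.Injective (fun p => ‖X p ω - y‖) := by
  have hbad : ∀ M : ℕ, ∀ᵐ ω ∂P, ¬ ((∀ i, Function.Injective (fun j : ℕ => X (i, j) ω)) ∧
      ∃ p q, p ≠ q ∧ ‖X p ω - y‖ = ‖X q ω - y‖ ∧ ‖X p ω - y‖ ^ 2 < M) := by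
    intro M
    rw [ae_iff]
    simp only [not_not]
    set C := ((∑ i, lam i) * (Real.pi * M)) ^ 2 with hC
    have hle : ∀ m : ℕ, P {ω | (∀ i, Function.Injective (fun j : ℕ => X (i, j) ω)) ∧
        ∃ p q, p ≠ q ∧ ‖X p ω - y‖ = ‖X q ω - y‖ ∧ ‖X p ω - y‖ ^ 2 < M} ≤
          ENNReal.ofReal (C / (m + 1 : ℕ)) := by
      intro m
      have hm : (0 : ℝ) < (m + 1 : ℕ) := by positivity
      -- Annuli of equal area `π M / (m + 1)` partition the disc of squared radius `M`. Each holds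
      -- two points with probability at most `C / (m + 1) ^ 2`, so the `m + 1` annuli together
      -- contribute at most `C / (m + 1)`.
      let A : ℕ → Set Plane := fun k =>
        (fun x : Plane => ‖x - y‖ ^ 2) ⁻¹' Ico (M * k / (m + 1 : ℕ)) (M * (k + 1) / (m + 1 : ℕ))
      have hA : ∀ k, MeasurableSet (A k) := fun k =>
        measurableSet_Ico.preimage (by fun_prop)
      calc P {ω | (∀ i, Function.Injective (fun j : ℕ => X (i, j) ω)) ∧
            ∃ p q, p ≠ q ∧ ‖X p ω - y‖ = ‖X q ω - y‖ ∧ ‖X p ω - y‖ ^ 2 < M}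
          ≤ P (⋃ k ∈ Finset.range (m + 1), {ω | 2 ≤ totalCount Φ (A k) ω}) := by
            refine measure_mono ?_
            rintro ω ⟨hinj, p, q, hpq, hd, hlt⟩
            have hM : (0 : ℝ) < M := (sq_nonneg _).trans_lt hlt
            -- Equal distances put both points into the same annulus, the one with index `⌊u (m + 1)
            -- / M⌋`.
            set u := ‖X p ω - y‖ ^ 2 with hu
            have hu0 : 0 ≤ u := sq_nonneg _
            set k := ⌊u * (m + 1 : ℕ) / M⌋₊ with hk
            have h1 : (k : ℝ) ≤ u * (m + 1 : ℕ) / M := Nat.floor_le (by positivity)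
            have h2 : u * (m + 1 : ℕ) / M < k + 1 := Nat.lt_floor_add_one _
            have hkm : k < m + 1 := by
              rw [hk, Nat.floor_lt (by positivity), div_lt_iff₀ hM, mul_comm]
              gcongr
            have hmem : u ∈ Ico (M * k / (m + 1 : ℕ) : ℝ) (M * (k + 1) / (m + 1 : ℕ)) := by
              rw [le_div_iff₀ hM] at h1
              rw [div_lt_iff₀ hM] at h2
              rw [mem_Ico, div_le_iff₀ hm, lt_div_iff₀ hm]
              constructor <;> linarith
            simp only [mem_iUnion, Finset.mem_range]
            refine ⟨k, hkm, totalCount_two_le hX hinj hpq hmem ?_⟩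
            rw [mem_preimage, ← hd]; exact hmem
        _ ≤ ∑ k ∈ Finset.range (m + 1), P {ω | 2 ≤ totalCount Φ (A k) ω} :=
            measure_biUnion_finset_le _ _
        _ ≤ ∑ k ∈ Finset.range (m + 1), ENNReal.ofReal (C / (m + 1 : ℕ) ^ 2) := by
            refine Finset.sum_le_sum fun k _ => ?_
            refine (measure_totalCount_two_le hlam hPoisson hindep (hA k)
              (isBounded_annulus y _ _)).trans_eq ?_
            rw [volume_real_annulus y (by positivity) (by gcongr; linarith)]
            congr 1
            rw [hC]; field_simp; ring
        _ = ENNReal.ofReal (C / (m + 1 : ℕ)) := by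
            rw [Finset.sum_const, Finset.card_range, nsmul_eq_mul, ← ENNReal.ofReal_natCast,
              ← ENNReal.ofReal_mul hm.le]
            congr 1
            field_simp
    have hlim : Tendsto (fun m : ℕ => ENNReal.ofReal (C / (m + 1 : ℕ))) atTop (𝓝 0) := by
      rw [← ENNReal.ofReal_zero]
      exact ENNReal.tendsto_ofReal
        ((tendsto_const_div_atTop_nhds_zero_nat C).comp (tendsto_add_atTop_nat 1))
    exact le_antisymm (ge_of_tendsto' hlim hle) zero_le
  filter_upwards [ae_all_iff.2 hbad, ae_all_iff.2 hXinj] with ω h1 h2 p q hpq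
  by_contra hne
  obtain ⟨M, hM⟩ := exists_nat_gt (‖X p ω - y‖ ^ 2)
  exact h1 M ⟨h2, p, q, hne, hpq, hM⟩

/-! ### Measurability of point counts, and the union of the processes -/

theorem measurable_encard_range_inter {κ : Type*} [Countable κ] {X : κ → Ω → Plane}
    (hX : ∀ p, Measurable (X p)) {B : Set Plane} (hB : MeasurableSet B) :
    Measurable (fun ω => (range (fun p => X p ω) ∩ B).encard) := by
  have hset : ∀ m : ℕ, MeasurableSet {ω | (m : ℕ∞) ≤ (range (fun p => X p ω) ∩ B).encard} := by
    intro m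
    -- At least `m` points means that some `m` indices have pairwise distinct locations in `B`.
    -- There are countably many finite index sets. Distinctness must be demanded, because the
    -- enumeration need not be injective at every `ω`.
    have : {ω | (m : ℕ∞) ≤ (range (fun p => X p ω) ∩ B).encard} =
        ⋃ s ∈ {s : Finset κ | s.card = m}, {ω | (∀ p ∈ s, X p ω ∈ B) ∧
          ∀ p ∈ s, ∀ q ∈ s, p ≠ q → X p ω ≠ X q ω} := by
      ext ω
      simp only [mem_ofPred_eq, mem_iUnion, exists_prop]
      constructor
      · intro h
        obtain ⟨t, ht, htm⟩ := exists_subset_encard_eq h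
        obtain ⟨u, hu, hinj⟩ := exists_image_eq_and_injOn
          ((fun p => X p ω) ⁻¹' t) (fun p => X p ω)
        rw [image_preimage_eq_inter_range,
          inter_eq_left.2 (ht.trans inter_subset_left)] at hu
        have hufin : u.Finite := by
          refine Finite.of_finite_image ?_ hinj
          rw [hu]
          exact finite_of_encard_eq_coe htm
        refine ⟨hufin.toFinset, ?_, ?_, ?_⟩
        · have := hinj.encard_image
          rw [hu, htm, hufin.encard_eq_coe_toFinset_card] at this
          exact_mod_cast this.symm
        · intro p hp
          have : X p ω ∈ t := hu ▸ mem_image_of_mem (fun p => X p ω) (hufin.mem_toFinset.1 hp)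
          exact (ht this).2
        · intro p hp q hq hpq h
          exact hpq (hinj (hufin.mem_toFinset.1 hp) (hufin.mem_toFinset.1 hq) h)
      · rintro ⟨s, hs, h1, h2⟩
        have hinj : InjOn (fun p => X p ω) s := fun p hp q hq h => by
          by_contra hne; exact h2 p hp q hq hne h
        rw [← hs, ← encard_coe_eq_coe_finsetCard, ← hinj.encard_image]
        refine encard_le_encard ?_
        rintro _ ⟨p, hp, rfl⟩
        exact ⟨mem_range_self p, h1 p hp⟩
    rw [this]
    refine MeasurableSet.biUnion (to_countable _) fun s _ => ?_
    have hs : {ω | (∀ p ∈ s, X p ω ∈ B) ∧ ∀ p ∈ s, ∀ q ∈ s, p ≠ q → X p ω ≠ X q ω} =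
        (⋂ p ∈ {p | p ∈ s}, X p ⁻¹' B) ∩
          ⋂ p ∈ {p | p ∈ s}, ⋂ q ∈ {p | p ∈ s}, ⋂ _ : p ≠ q, {ω | X p ω = X q ω}ᶜ := by
      ext ω; simp
    rw [hs]
    refine MeasurableSet.inter ?_ ?_
    · exact MeasurableSet.biInter (to_countable {p | p ∈ s}) fun p _ => hX p hB
    · exact MeasurableSet.biInter (to_countable {p | p ∈ s}) fun p _ =>
        MeasurableSet.biInter (to_countable {p | p ∈ s}) fun q _ =>
          MeasurableSet.iInter fun _ => (measurableSet_eq_fun (hX p) (hX q)).compl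
  refine measurable_to_countable' fun m => ?_
  induction m with
  | top =>
    have : (fun ω => (range (fun p => X p ω) ∩ B).encard) ⁻¹' {⊤} =
        ⋂ m : ℕ, {ω | (m : ℕ∞) ≤ (range (fun p => X p ω) ∩ B).encard} := by
      ext ω
      simp only [mem_preimage, mem_singleton_iff, mem_iInter, mem_ofPred_eq]
      exact ⟨fun h m => h ▸ le_top, fun h => ENat.eq_top_iff_forall_ge.2 h⟩
    rw [this]
    exact MeasurableSet.iInter hset
  | coe m =>
    have : (fun ω => (range (fun p => X p ω) ∩ B).encard) ⁻¹' {(m : ℕ∞)} =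
        {ω | (m : ℕ∞) ≤ (range (fun p => X p ω) ∩ B).encard} \
          {ω | ((m + 1 : ℕ) : ℕ∞) ≤ (range (fun p => X p ω) ∩ B).encard} := by
      ext ω
      simp only [mem_preimage, mem_singleton_iff, Set.mem_sdiff, mem_ofPred_eq, not_le]
      constructor
      · intro h; rw [h]; exact ⟨le_rfl, by exact_mod_cast Nat.lt_succ_self m⟩
      · rintro ⟨h1, h2⟩
        refine le_antisymm ?_ h1
        exact ENat.lt_add_one_iff (ENat.natCast_ne_top m) |>.1 (by exact_mod_cast h2)
    rw [this]
    exact (hset m).diff (hset (m + 1))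

theorem ae_pointCount_iUnion_eq_totalCount [Fintype N] {X : N × ℕ → Ω → Plane}
    (hX : ∀ i ω, Φ i ω = range (fun j : ℕ => X (i, j) ω))
    (hinj : ∀ᵐ ω ∂P, Function.Injective (fun p => X p ω)) (B : Set Plane) :
    pointCount (fun ω => ⋃ i, Φ i ω) B =ᵐ[P] totalCount Φ B := by
  filter_upwards [hinj] with ω h
  simp only [pointCount, totalCount, iUnion_inter]
  rw [encard_iUnion_of_finite, finsum_eq_sum_of_fintype]
  intro i j hij
  refine Disjoint.mono inter_subset_left inter_subset_left ?_
  rw [hX, hX, Set.disjoint_left]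
  rintro _ ⟨a, rfl⟩ ⟨b, hb⟩
  exact hij (congrArg Prod.fst (h hb)).symm

/-- The union of independent Poisson processes is a Poisson process with the summed intensity. -/
theorem isPoissonPointProcess_iUnion [Fintype N] [IsProbabilityMeasure P] (hlam : ∀ i, 0 < lam i)
    {X : N × ℕ → Ω → Plane} (hXm : ∀ p, Measurable (X p))
    (hX : ∀ i ω, Φ i ω = range (fun j : ℕ => X (i, j) ω))
    (hinj : ∀ᵐ ω ∂P, Function.Injective (fun p => X p ω))
    (hPoisson : ∀ i, IsPoissonPointProcess P (Φ i) (lam i))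
    (hindep : iIndep (fun i => pointSigmaAlgebra (Φ i)) P) :
    IsPoissonPointProcess P (fun ω => ⋃ i, Φ i ω) (∑ i, lam i) where
  locallyFinite := by
    filter_upwards [ae_all_iff.2 fun i => (hPoisson i).locallyFinite] with ω h B hB
    rw [iUnion_inter]
    exact finite_iUnion fun i => h i B hB
  measurable_count B hB m := by
    have := measurable_encard_range_inter hXm hB (measurableSet_singleton m)
    simp only [pointCount, iUnion_eq_range hX]
    exact this
  poisson_count B hB hBb m := by
    have h1 : P {ω | pointCount (fun ω => ⋃ i, Φ i ω) B ω = m} =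
        P {ω | totalCount Φ B ω = m} := by
      refine measure_congr ?_
      filter_upwards [ae_pointCount_iUnion_eq_totalCount hX hinj B] with ω h
      exact congrArg (· = (m : ℕ∞)) h
    rw [h1, (hasLaw_totalCount hlam hPoisson hindep hB hBb).measure_eq (p := fun k => k = (m : ℕ∞))
      .of_discrete, Measure.map_apply .of_discrete .of_discrete]
    congr 1
    ext k; simp
  independent_counts m B hB hBb hd :=
    (iIndepFun_totalCount hPoisson hindep hB hBb hd).congr fun j =>
      (ae_pointCount_iUnion_eq_totalCount hX hinj (B j)).symm

end Superposition

/-! ## The exponential `exp (-t)` of an extended nonnegative real -/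

/-- `exp (-t)` for `t ∈ [0, ∞]`. -/
noncomputable def negExp (t : ℝ≥0∞) : ℝ≥0∞ := EReal.exp (-(t : EReal))

@[simp] theorem negExp_zero : negExp 0 = 1 := by simp [negExp]

@[simp] theorem negExp_top : negExp ∞ = 0 := by simp [negExp]

theorem negExp_antitone : Antitone negExp := fun a b h => by
  refine EReal.exp_monotone ?_
  rw [EReal.neg_le_neg_iff]
  exact_mod_cast h

theorem negExp_le_one (t : ℝ≥0∞) : negExp t ≤ 1 :=
  (negExp_antitone zero_le).trans_eq negExp_zero

theorem continuous_negExp : Continuous negExp :=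
  ENNReal.continuous_exp.comp (continuous_neg.comp continuous_coe_ennreal_ereal)

@[fun_prop] theorem measurable_negExp : Measurable negExp := continuous_negExp.measurable

theorem negExp_ofReal {r : ℝ} (hr : 0 ≤ r) : negExp (ENNReal.ofReal r) = ENNReal.ofReal (Real.exp (-r)) := by
  rw [negExp, EReal.coe_ennreal_ofReal, max_eq_left hr, ← EReal.coe_neg, EReal.exp_coe]

theorem negExp_ne_top (t : ℝ≥0∞) : negExp t ≠ ∞ :=
  ((negExp_le_one t).trans_lt ENNReal.one_lt_top).ne

/-- With `exp (-∞) = 0` the rule has no exceptional case, which is what permits infinite test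
functions later. -/
theorem negExp_add (a b : ℝ≥0∞) : negExp (a + b) = negExp a * negExp b := by
  rw [negExp, negExp, negExp, EReal.coe_ennreal_add, ← EReal.exp_add, EReal.neg_add, sub_eq_add_neg]
  · left; exact EReal.coe_ennreal_ne_bot a
  · right; exact EReal.coe_ennreal_ne_bot b

theorem negExp_sum {ι : Type*} (s : Finset ι) (f : ι → ℝ≥0∞) :
    negExp (∑ i ∈ s, f i) = ∏ i ∈ s, negExp (f i) := by
  classical
  induction s using Finset.induction_on with
  | empty => simp
  | insert a s ha ih => rw [Finset.sum_insert ha, negExp_add, ih, Finset.prod_insert ha]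

/-! ## The Laplace functional of a Poisson point process -/

/-- The generating function of the Poisson law at `exp (-c)`, summed as an exponential series. -/
theorem lintegral_negExp_mul_poissonMeasure (r : ℝ≥0) {c : ℝ≥0∞} (hc : c ≠ ∞) :
    ∫⁻ m, negExp (c * (m : ℝ≥0∞)) ∂(poissonMeasure r) = negExp (r * (1 - negExp c)) := by
  lift c to ℝ≥0 using hc
  have hneg : negExp (c : ℝ≥0∞) = ENNReal.ofReal (Real.exp (-c)) := by
    rw [← negExp_ofReal c.coe_nonneg, ENNReal.ofReal_coe_nnreal]
  have hle : Real.exp (-(c : ℝ)) ≤ 1 := Real.exp_le_one_iff.2 (by simp)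
  rw [lintegral_countable']
  have hterm : ∀ m : ℕ, negExp (c * (m : ℝ≥0∞)) * poissonMeasure r {m} =
      ENNReal.ofReal (Real.exp (-r) * ((r * Real.exp (-c)) ^ m / m.factorial)) := by
    intro m
    have h1 : (c : ℝ≥0∞) * m = ENNReal.ofReal (c * m) := by
      rw [ENNReal.ofReal_mul c.coe_nonneg, ENNReal.ofReal_coe_nnreal, ENNReal.ofReal_natCast]
    rw [h1, negExp_ofReal (by positivity), poissonMeasure_singleton,
      ← ENNReal.ofReal_mul (Real.exp_pos _).le]
    congr 1
    have h2 : Real.exp (-((c : ℝ) * m)) = Real.exp (-c) ^ m := by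
      rw [← Real.exp_nat_mul]; congr 1; ring
    rw [h2, mul_pow]; ring
  have hsum : HasSum (fun m : ℕ => Real.exp (-r) * ((r * Real.exp (-c)) ^ m / m.factorial))
      (Real.exp (-r) * Real.exp (r * Real.exp (-c))) := by
    have := NormedSpace.expSeries_div_hasSum_exp ((r : ℝ) * Real.exp (-c))
    rw [← Real.exp_eq_exp_ℝ] at this
    exact this.mul_left _
  simp_rw [hterm]
  rw [← ENNReal.ofReal_tsum_of_nonneg (fun m => by positivity) hsum.summable, hsum.tsum_eq, hneg,
    ← ENNReal.ofReal_one, ← ENNReal.ofReal_sub _ (Real.exp_pos _).le, ← ENNReal.ofReal_coe_nnreal,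
    ← ENNReal.ofReal_mul r.coe_nonneg, negExp_ofReal (mul_nonneg r.coe_nonneg (by linarith)), ← Real.exp_add]
  congr 2
  ring

section Laplace

variable {Ω κ : Type*} [MeasurableSpace Ω] {P : Measure Ω} {X : κ → Ω → Plane}

/-- The sum of the Dirac measures at the points of a configuration. -/
noncomputable def pointMeasure {κ E : Type*} [MeasurableSpace E] (x : κ → E) : Measure E :=
  Measure.sum fun p => Measure.dirac (x p)

theorem lintegral_pointMeasure {κ E : Type*} [MeasurableSpace E] (x : κ → E) {φ : E → ℝ≥0∞}
    (hφ : Measurable φ) :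
    ∫⁻ z, φ z ∂(pointMeasure x) = ∑' p, φ (x p) := by
  simp only [pointMeasure, lintegral_sum_measure, lintegral_dirac' _ hφ]

/-- The measure counts indices with multiplicity, so injectivity is needed to identify it with a
number of points. -/
theorem pointMeasure_apply {x : κ → Plane} (hinj : Function.Injective x) {B : Set Plane}
    (hB : MeasurableSet B) : pointMeasure x B = ((range x ∩ B).encard : ℝ≥0∞) := by
  rw [← lintegral_indicator_one hB, lintegral_pointMeasure x (measurable_one.indicator hB),
    ← image_preimage_eq_range_inter, hinj.encard_image, ← ENNReal.tsum_set_one,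
    tsum_subtype (x ⁻¹' B) fun _ => (1 : ℝ≥0∞)]
  rfl

theorem IsPoissonPointProcess.lintegral_negExp_pointCount [IsProbabilityMeasure P]
    {Φ : Ω → Set Plane} {lam : ℝ} (hlam : 0 ≤ lam) (hΦ : IsPoissonPointProcess P Φ lam)
    {B : Set Plane} (hB : MeasurableSet B) (hBb : Bornology.IsBounded B) {c : ℝ≥0∞} (hc : c ≠ ∞) :
    ∫⁻ ω, negExp (c * (pointCount Φ B ω : ℝ≥0∞)) ∂P =
      negExp (ENNReal.ofReal lam * ((1 - negExp c) * volume B)) := by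
  have hlaw := hΦ.hasLaw_pointCount hB hBb
  have hcount : Measurable (fun m : ℕ∞ => negExp (c * (m : ℝ≥0∞))) := .of_discrete
  have hmap := lintegral_map hcount (hΦ.measurable_pointCount hB) (μ := P)
  rw [← hmap, hlaw.map_eq, lintegral_map hcount .of_discrete]
  simp only [ENat.toENNReal_coe]
  rw [lintegral_negExp_mul_poissonMeasure _ hc]
  congr 1
  have : ((lam * volume.real B).toNNReal : ℝ≥0∞) = ENNReal.ofReal lam * volume B := by
    rw [← ofReal_measureReal (μ := volume) (s := B) hBb.measure_lt_top.ne, ← ENNReal.ofReal_mul hlam]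
    rfl
  rw [this]; ring

theorem IsPoissonPointProcess.lintegral_negExp_sum [IsProbabilityMeasure P]
    {Φ : Ω → Set Plane} {lam : ℝ} (hlam : 0 ≤ lam) (hΦ : IsPoissonPointProcess P Φ lam)
    {ι : Type*} (S : Finset ι) {B : ι → Set Plane} (hB : ∀ j ∈ S, MeasurableSet (B j))
    (hBb : ∀ j ∈ S, Bornology.IsBounded (B j))
    (hd : ∀ i ∈ S, ∀ j ∈ S, i ≠ j → Disjoint (B i) (B j)) {c : ι → ℝ≥0∞} (hc : ∀ j ∈ S, c j ≠ ∞) :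
    ∫⁻ ω, negExp (∑ j ∈ S, c j * (pointCount Φ (B j) ω : ℝ≥0∞)) ∂P =
      negExp (ENNReal.ofReal lam * ∑ j ∈ S, (1 - negExp (c j)) * volume (B j)) := by
  let e := S.equivFin
  have hind : iIndepFun (fun j => pointCount Φ (B (e.symm j))) P :=
    hΦ.independent_counts S.card (fun j => B (e.symm j)) (fun j => hB _ (e.symm j).2)
      (fun j => hBb _ (e.symm j).2) (fun i j hij => hd _ (e.symm i).2 _ (e.symm j).2
        fun h => hij (e.symm.injective (Subtype.ext h)))
  have hm : ∀ j, Measurable (fun m : ℕ∞ => negExp (c (e.symm j) * (m : ℝ≥0∞))) :=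
    fun j => .of_discrete
  have hre : ∀ f : ι → ℝ≥0∞, ∑ j ∈ S, f j = ∑ j, f (e.symm j) := fun f => by
    rw [← Finset.sum_coe_sort]
    exact (Equiv.sum_comp e.symm (fun j : S => f j)).symm
  simp_rw [hre, negExp_sum]
  have hmc : ∀ j, Measurable (pointCount Φ (B (e.symm j))) :=
    fun j => hΦ.measurable_pointCount (hB _ (e.symm j).2)
  have h2 := lintegral_prod_eq_prod_lintegral_of_indepFun Finset.univ _ (hind.comp _ hm)
    fun j => (hm j).comp (hmc j)
  simp only [Function.comp_apply] at h2
  rw [h2, Finset.mul_sum, negExp_sum]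
  exact Finset.prod_congr rfl fun j _ => hΦ.lintegral_negExp_pointCount hlam
    (hB _ (e.symm j).2) (hBb _ (e.symm j).2) (hc _ (e.symm j).2)

theorem laplace_simpleFunc [IsProbabilityMeasure P]
    (hinj : ∀ᵐ ω ∂P, Function.Injective (fun p => X p ω)) {lam : ℝ} (hlam : 0 ≤ lam)
    (hΦ : IsPoissonPointProcess P (fun ω => range (fun p => X p ω)) lam)
    (s : SimpleFunc Plane ℝ≥0∞) (hfin : ∀ x, s x ≠ ∞)
    (hsupp : Bornology.IsBounded (Function.support s)) :
    ∫⁻ ω, negExp (∑' p, s (X p ω)) ∂P =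
      negExp (ENNReal.ofReal lam * ∫⁻ x, (1 - negExp (s x))) := by
  classical
  -- The level set of the value zero is dropped: it is unbounded, and the Poisson property concerns
  -- bounded sets. On the remaining level sets the sum over the points is a finite combination of
  -- independent counts.
  let S := s.range.filter (· ≠ 0)
  have hsum : ∀ (g : ℝ≥0∞ → ℝ≥0∞) (μ : Measure Plane), g 0 = 0 →
      ∫⁻ x, g (s x) ∂μ = ∑ c ∈ S, g c * μ (s ⁻¹' {c}) := by
    intro g μ hg
    have : ∫⁻ x, g (s x) ∂μ = (s.map g).lintegral μ := by
      rw [← SimpleFunc.lintegral_eq_lintegral]; rfl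
    rw [this, SimpleFunc.map_lintegral, Finset.sum_filter]
    refine Finset.sum_congr rfl fun c _ => ?_
    split_ifs with h
    · rfl
    · rw [not_not.1 h, hg, zero_mul]
  have hne : ∀ c ∈ S, c ≠ 0 := fun c hc => (Finset.mem_filter.1 hc).2
  rw [hsum (fun t => 1 - negExp t) _ (by simp),
    ← hΦ.lintegral_negExp_sum hlam S (B := fun c => s ⁻¹' {c}) (c := fun c => c)
      (fun c _ => s.measurableSet_fiber c)
      (fun c hc => hsupp.subset fun x hx => by
        rw [Function.mem_support, (mem_preimage.1 hx : s x = c)]; exact hne c hc)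
      (fun i _ j _ hij => Disjoint.preimage _ (by simpa using hij))
      (fun c hc => by
        obtain ⟨x, rfl⟩ := SimpleFunc.mem_range.1 (Finset.mem_filter.1 hc).1
        exact hfin x)]
  refine lintegral_congr_ae ?_
  filter_upwards [hinj] with ω h
  rw [← lintegral_pointMeasure (fun p => X p ω) s.measurable, hsum (fun c => c) _ rfl]
  congr 1
  exact Finset.sum_congr rfl fun c _ => by
    rw [pointMeasure_apply h (s.measurableSet_fiber c)]; rfl

/-- The Laplace functional of a Poisson point process, for test functions with values in
`[0, ∞]`. -/
theorem laplace_functional [Countable κ] [IsProbabilityMeasure P] (hX : ∀ p, Measurable (X p))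
    (hinj : ∀ᵐ ω ∂P, Function.Injective (fun p => X p ω)) {lam : ℝ} (hlam : 0 ≤ lam)
    (hΦ : IsPoissonPointProcess P (fun ω => range (fun p => X p ω)) lam)
    {φ : Plane → ℝ≥0∞} (hφ : Measurable φ) :
    ∫⁻ ω, negExp (∑' p, φ (X p ω)) ∂P =
      negExp (ENNReal.ofReal lam * ∫⁻ x, (1 - negExp (φ x))) := by
  -- Simple approximations from below, cut off to balls so that their supports are bounded. The left
  -- side converges by domination by `1`, the right side by monotone convergence.
  let s : ℕ → SimpleFunc Plane ℝ≥0∞ := fun n =>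
    (SimpleFunc.eapprox φ n).restrict (Metric.ball 0 n)
  have hs : ∀ n x, s n x = (Metric.ball 0 n).indicator (SimpleFunc.eapprox φ n) x := fun n x => by
    rw [SimpleFunc.restrict_apply _ Metric.isOpen_ball.measurableSet]
  have hmono : ∀ x, Monotone fun n => s n x := by
    intro x m n hmn
    simp only [hs]
    refine (indicator_le_indicator_of_subset (Metric.ball_subset_ball (by exact_mod_cast hmn))
      (fun _ => zero_le) x).trans (indicator_le_indicator ?_)
    exact SimpleFunc.monotone_eapprox φ hmn x
  have hlim : ∀ x, Tendsto (fun n => s n x) atTop (𝓝 (φ x)) := by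
    intro x
    refine (SimpleFunc.tendsto_eapprox hφ x).congr' ?_
    obtain ⟨M, hM⟩ := exists_nat_gt ‖x‖
    filter_upwards [eventually_ge_atTop M] with n hn
    rw [hs, indicator_of_mem]
    rw [Metric.mem_ball, dist_zero_right]
    exact hM.trans_le (by exact_mod_cast hn)
  have hsn : ∀ n, ∫⁻ ω, negExp (∑' p, s n (X p ω)) ∂P =
      negExp (ENNReal.ofReal lam * ∫⁻ x, (1 - negExp (s n x))) := by
    refine fun n => laplace_simpleFunc hinj hlam hΦ (s n) (fun x => ?_)
      ((Metric.isBounded_ball (x := (0 : Plane)) (r := n)).subset fun x hx => ?_)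
    · rw [hs]
      by_cases hx : x ∈ Metric.ball (0 : Plane) n
      · rw [indicator_of_mem hx]; exact (SimpleFunc.eapprox_lt_top φ n x).ne
      · rw [indicator_of_notMem hx]; exact ENNReal.zero_ne_top
    · rw [Function.mem_support, hs] at hx
      by_contra h
      exact hx (indicator_of_notMem h _)
  have hl : Tendsto (fun n => ∫⁻ ω, negExp (∑' p, s n (X p ω)) ∂P) atTop
      (𝓝 (∫⁻ ω, negExp (∑' p, φ (X p ω)) ∂P)) := by
    refine tendsto_lintegral_of_dominated_convergence (fun _ => 1) (fun n => ?_)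
      (fun n => ae_of_all _ fun ω => negExp_le_one _) (by simp) (ae_of_all _ fun ω => ?_)
    · exact measurable_negExp.comp (Measurable.tsum fun p => (s n).measurable.comp (hX p))
    · refine (continuous_negExp.tendsto _).comp ?_
      rw [← lintegral_pointMeasure (fun p => X p ω) hφ]
      simp_rw [← lintegral_pointMeasure (fun p => X p ω) (s _).measurable]
      exact lintegral_tendsto_of_tendsto_of_monotone (fun n => (s n).measurable.aemeasurable)
        (ae_of_all _ hmono) (ae_of_all _ hlim)
  have hr : Tendsto (fun n => negExp (ENNReal.ofReal lam * ∫⁻ x, (1 - negExp (s n x)))) atTop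
      (𝓝 (negExp (ENNReal.ofReal lam * ∫⁻ x, (1 - negExp (φ x))))) := by
    refine (continuous_negExp.tendsto _).comp
      (ENNReal.Tendsto.const_mul ?_ (Or.inr ENNReal.ofReal_ne_top))
    refine lintegral_tendsto_of_tendsto_of_monotone
      (fun n => (measurable_const.sub (measurable_negExp.comp (s n).measurable)).aemeasurable)
      (ae_of_all _ fun x m n hmn => tsub_le_tsub_left (negExp_antitone (hmono x hmn)) 1)
      (ae_of_all _ fun x => ?_)
    exact ENNReal.Tendsto.sub tendsto_const_nhds ((continuous_negExp.tendsto _).comp (hlim x))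
      (Or.inl ENNReal.one_ne_top)
  simp_rw [hsn] at hl
  exact tendsto_nhds_unique hl hr

theorem laplace_functional_sq_dist [Countable κ] [IsProbabilityMeasure P]
    (hX : ∀ p, Measurable (X p)) (hinj : ∀ᵐ ω ∂P, Function.Injective (fun p => X p ω))
    {lam : ℝ} (hlam : 0 ≤ lam)
    (hΦ : IsPoissonPointProcess P (fun ω => range (fun p => X p ω)) lam) (y : Plane)
    {ψ : ℝ → ℝ≥0∞} (hψ : Measurable ψ) :
    ∫⁻ ω, negExp (∑' p, ψ (‖X p ω - y‖ ^ 2)) ∂P =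
      negExp (ENNReal.ofReal (lam * Real.pi) * ∫⁻ u in Ici 0, (1 - negExp (ψ u))) := by
  have hd : Measurable (fun x : Plane => ‖x - y‖ ^ 2) := by fun_prop
  rw [laplace_functional hX hinj hlam hΦ (φ := fun x => ψ (‖x - y‖ ^ 2)) (hψ.comp hd),
    ← lintegral_map (f := fun u => 1 - negExp (ψ u)) (by fun_prop) hd,
    map_sq_dist_volume, lintegral_smul_measure, smul_eq_mul, ← mul_assoc, ENNReal.ofReal_mul hlam]

end Laplace

/-! ## Euler's integral for `₂F₁(1, b; b + 1; z)` -/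

theorem integrableOn_rpow_sub_one {b : ℝ} (hb : 0 < b) :
    IntegrableOn (fun t : ℝ => t ^ (b - 1)) (Ioc 0 1) := by
  have := intervalIntegral.intervalIntegrable_rpow' (a := 0) (b := 1) (r := b - 1) (by linarith)
  rwa [intervalIntegrable_iff_integrableOn_Ioc_of_le zero_le_one] at this

theorem integral_rpow_sub_one_mul_pow {b : ℝ} (hb : 0 < b) (n : ℕ) :
    ∫ t in Ioc (0 : ℝ) 1, t ^ (b - 1) * t ^ n = 1 / (b + n) := by
  have h : ∀ t ∈ Ioc (0 : ℝ) 1, t ^ (b - 1) * t ^ n = t ^ (b - 1 + n) := fun t ht => by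
    rw [Real.rpow_add ht.1, Real.rpow_natCast]
  have hn : (0 : ℝ) ≤ n := n.cast_nonneg
  rw [setIntegral_congr_fun measurableSet_Ioc h, ← intervalIntegral.integral_of_le zero_le_one,
    integral_rpow (Or.inl (by linarith)), Real.one_rpow, Real.zero_rpow (by linarith)]
  congr 1 <;> ring

/-- The real part `1 - t * z.re` is at least `1` when `z.re ≤ 0`, and at least `1 - z.re` otherwise.
-/
theorem one_sub_mul_re_bound {z : ℂ} {ε : ℝ} (hz : z.re ≤ 1 - ε) {t : ℝ}
    (ht : t ∈ Ioc (0 : ℝ) 1) : min 1 ε ≤ ‖1 - z * t‖ := by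
  refine le_trans ?_ (Complex.re_le_norm _)
  have h : (1 - z * t).re = 1 - z.re * t := by simp
  rw [h]
  rcases le_or_gt z.re 0 with h0 | h0
  · exact (min_le_left _ _).trans (by nlinarith [ht.1])
  · exact (min_le_right _ _).trans (by nlinarith [ht.1, ht.2])

/-- The complex variable serves to obtain analyticity: complex differentiability on an open
half-plane suffices, and differentiation under the integral provides it. -/
theorem differentiableOn_euler_integral {b : ℝ} (hb : 0 < b) :
    DifferentiableOn ℂ (fun z : ℂ => ∫ t in Ioc (0 : ℝ) 1, ((t ^ (b - 1) : ℝ) : ℂ) / (1 - z * t))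
      {z | z.re < 1} := by
  intro z₀ hz₀
  have hz₀ : z₀.re < 1 := hz₀
  -- Half the distance to the line `z.re = 1`: on the ball of this radius the denominators stay
  -- bounded away from zero.
  set ε := (1 - z₀.re) / 2 with hε
  have hεpos : 0 < ε := by rw [hε]; linarith
  have hre : ∀ z ∈ Metric.ball z₀ ε, z.re ≤ 1 - ε := by
    intro z hz
    have h1 := (Complex.abs_re_le_norm (z - z₀)).trans_lt (by rwa [← dist_eq_norm])
    have h2 := (abs_lt.1 h1).2
    rw [Complex.sub_re] at h2
    rw [hε] at h2 ⊢; linarith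
  set m := min 1 ε with hm
  have hmpos : 0 < m := lt_min one_pos hεpos
  have hmeas : ∀ z : ℂ, Measurable fun t : ℝ => ((t ^ (b - 1) : ℝ) : ℂ) / (1 - z * t) :=
    fun z => by fun_prop
  have hkey := hasDerivAt_integral_of_dominated_loc_of_deriv_le
    (μ := volume.restrict (Ioc (0 : ℝ) 1)) (𝕜 := ℂ)
    (F := fun z t => ((t ^ (b - 1) : ℝ) : ℂ) / (1 - z * t))
    (F' := fun z t => ((t ^ (b - 1) : ℝ) : ℂ) * t / (1 - z * t) ^ 2)
    (bound := fun t => (1 / m ^ 2) * t ^ (b - 1)) (x₀ := z₀) (s := Metric.ball z₀ ε)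
    (Metric.ball_mem_nhds z₀ hεpos) (Eventually.of_forall fun z => (hmeas z).aestronglyMeasurable)
    ?_ ?_ ?_ ((integrableOn_rpow_sub_one hb).const_mul _) ?_
  · exact hkey.2.differentiableAt.differentiableWithinAt
  · refine Integrable.mono' ((integrableOn_rpow_sub_one hb).const_mul (1 / m))
      (hmeas z₀).aestronglyMeasurable ?_
    filter_upwards [ae_restrict_mem measurableSet_Ioc] with t ht
    have h1 := one_sub_mul_re_bound (hre z₀ (Metric.mem_ball_self hεpos)) ht
    have h2 : 0 ≤ t ^ (b - 1) := Real.rpow_nonneg ht.1.le _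
    rw [norm_div, Complex.norm_real, Real.norm_of_nonneg h2, div_eq_mul_inv, mul_comm, ← one_div]
    gcongr
  · have : Measurable fun t : ℝ => ((t ^ (b - 1) : ℝ) : ℂ) * t / (1 - z₀ * t) ^ 2 := by fun_prop
    exact this.aestronglyMeasurable
  · filter_upwards [ae_restrict_mem measurableSet_Ioc] with t ht z hz
    have h1 := one_sub_mul_re_bound (hre z hz) ht
    have h2 : 0 ≤ t ^ (b - 1) := Real.rpow_nonneg ht.1.le _
    rw [norm_div, norm_mul, Complex.norm_real, Complex.norm_real, Real.norm_of_nonneg h2,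
      Real.norm_of_nonneg ht.1.le, norm_pow, div_eq_mul_inv, mul_comm, ← one_div]
    gcongr
    · exact mul_nonneg h2 ht.1.le
    · exact mul_le_of_le_one_right h2 ht.2
  · filter_upwards [ae_restrict_mem measurableSet_Ioc] with t ht z hz
    have h1 := hmpos.trans_le (one_sub_mul_re_bound (hre z hz) ht)
    have h0 : (1 - z * t) ≠ 0 := norm_pos_iff.1 h1
    have hd : HasDerivAt (fun z : ℂ => 1 - z * t) (-(1 * (t : ℂ))) z :=
      ((hasDerivAt_id z).mul_const (t : ℂ)).const_sub 1
    exact ((hasDerivAt_const z ((t ^ (b - 1) : ℝ) : ℂ)).div hd h0).congr_deriv (by ring)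

/-- Euler's integral is the analytic continuation of `₂F₁(1, b; b + 1; z)` to `z < 1`. -/
theorem isHypergeometricContinuation_euler_integral {b : ℝ} (hb : 0 < b) :
    IsHypergeometricContinuation 1 b (b + 1)
      (fun z => b * ∫ t in Ioc (0 : ℝ) 1, t ^ (b - 1) / (1 - z * t)) := by
  constructor
  · intro x hx
    have hopen : IsOpen {z : ℂ | z.re < 1} := isOpen_lt Complex.continuous_re continuous_const
    have han := (differentiableOn_euler_integral hb).analyticAt (z := (x : ℂ))
      (hopen.mem_nhds (by simpa using hx))
    have h1 : AnalyticAt ℝ (fun z : ℂ =>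
        ∫ t in Ioc (0 : ℝ) 1, ((t ^ (b - 1) : ℝ) : ℂ) / (1 - z * t)) (x : ℂ) :=
      han.restrictScalars
    have h2 : AnalyticAt ℝ (fun x : ℝ => (x : ℂ)) x := Complex.ofRealCLM.analyticAt x
    have h3 := (Complex.reCLM.analyticAt _).comp (h1.comp h2)
    refine analyticAt_const.mul (h3.congr (Eventually.of_forall fun z => ?_))
    simp only [Function.comp_apply, Complex.reCLM_apply]
    rw [← Complex.ofReal_re (∫ t in Ioc (0 : ℝ) 1, t ^ (b - 1) / (1 - z * t)),
      ← integral_complex_ofReal]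
    congr 2
    ext t
    push_cast
    rfl
  · intro z hz
    have habs : |z| < 1 := abs_lt.2 hz
    -- Here `(1)ₙ / n! = 1`, and `(b)ₙ / (b + 1)ₙ` telescopes to `b / (b + n)`, which is `b` times
    -- the moment `∫ t ^ (b - 1 + n)`. Hence the series is a termwise integrated geometric series.
    have hcoef : ∀ n : ℕ, ((n.factorial : ℝ)⁻¹ * (ascPochhammer ℝ n).eval 1 *
        (ascPochhammer ℝ n).eval b * ((ascPochhammer ℝ n).eval (b + 1))⁻¹) = b * (1 / (b + n)) := by
      intro n
      have hpos : 0 < (ascPochhammer ℝ n).eval (b + 1) := ascPochhammer_pos n _ (by linarith)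
      have hbn : 0 < b + n := by positivity
      have h1 : (ascPochhammer ℝ n).eval b * (b + n) = b * (ascPochhammer ℝ n).eval (b + 1) := by
        rw [← ascPochhammer_succ_eval, ascPochhammer_succ_left]
        simp
      rw [ascPochhammer_eval_one, inv_mul_cancel₀ (by positivity), one_mul, ← div_eq_mul_inv,
        div_eq_iff hpos.ne', mul_one_div, div_mul_eq_mul_div, eq_div_iff hbn.ne', h1]
    have hint : ∀ n : ℕ, IntegrableOn (fun t : ℝ => z ^ n * (t ^ (b - 1) * t ^ n)) (Ioc 0 1) := by
      intro n
      refine Integrable.const_mul ?_ _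
      refine Integrable.mono' (integrableOn_rpow_sub_one hb) (by fun_prop) ?_
      filter_upwards [ae_restrict_mem measurableSet_Ioc] with t ht
      have h2 : 0 ≤ t ^ (b - 1) := Real.rpow_nonneg ht.1.le _
      rw [norm_mul, Real.norm_of_nonneg h2, norm_pow, Real.norm_of_nonneg ht.1.le]
      exact mul_le_of_le_one_right h2 (pow_le_one₀ ht.1.le ht.2)
    have hnorm : ∀ n : ℕ, ∫ t in Ioc (0 : ℝ) 1, ‖z ^ n * (t ^ (b - 1) * t ^ n)‖ =
        |z| ^ n * (1 / (b + n)) := by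
      intro n
      rw [← integral_rpow_sub_one_mul_pow hb n, ← integral_const_mul]
      refine setIntegral_congr_fun measurableSet_Ioc fun t ht => ?_
      have h2 : 0 ≤ t ^ (b - 1) := Real.rpow_nonneg ht.1.le _
      have h3 : 0 ≤ t ^ (b - 1) * t ^ n := mul_nonneg h2 (pow_nonneg ht.1.le n)
      simp only [norm_mul (z ^ n), Real.norm_of_nonneg h3, norm_pow, Real.norm_eq_abs]
    have hsum := hasSum_integral_of_summable_integral_norm hint (by
      simp_rw [hnorm]
      refine Summable.of_nonneg_of_le (fun n => by positivity) (fun n => ?_)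
        ((summable_geometric_of_lt_one (abs_nonneg z) habs).mul_right (1 / b))
      gcongr
      linarith [n.cast_nonneg (α := ℝ)])
    have hgeom : ∀ t ∈ Ioc (0 : ℝ) 1, ∑' n : ℕ, z ^ n * (t ^ (b - 1) * t ^ n) =
        t ^ (b - 1) / (1 - z * t) := by
      intro t ht
      have hzt : |z * t| < 1 := by
        rw [abs_mul, abs_of_pos ht.1]
        exact (mul_le_of_le_one_right (abs_nonneg z) ht.2).trans_lt habs
      rw [div_eq_mul_inv, ← tsum_geometric_of_norm_lt_one hzt, ← tsum_mul_left]
      exact tsum_congr fun n => by rw [mul_pow]; ring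
    rw [setIntegral_congr_fun measurableSet_Ioc hgeom] at hsum
    simp only [integral_const_mul, integral_rpow_sub_one_mul_pow hb] at hsum
    rw [ordinaryHypergeometric_eq_tsum]
    simp only [hcoef, smul_eq_mul]
    rw [← hsum.tsum_eq, ← tsum_mul_left]
    exact tsum_congr fun n => by ring

/-! ### The interference factor as an integral -/

theorem interferenceFactor_eq {α θ : ℝ} (hα : 2 < α) (hθ : 0 ≤ θ) :
    interferenceFactor θ α =
      2 * θ / α * ∫ t in Ioc (0 : ℝ) 1, t ^ (-(2 / α)) / (1 + θ * t) := by
  have hα0 : 0 < α := by linarith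
  have hb : 0 < 1 - 2 / α := by rw [sub_pos, div_lt_one hα0]; exact hα
  have h := (isHypergeometricContinuation_euler_integral hb).gaussHypergeometric_eq
    (z := -θ) (by linarith)
  rw [interferenceFactor, show 2 - 2 / α = 1 - 2 / α + 1 by ring, h, ← mul_assoc]
  have h1 : α - 2 ≠ 0 := by linarith
  congr 1
  · field_simp
  · simp only [neg_mul, sub_neg_eq_add, show 1 - 2 / α - 1 = -(2 / α) by ring]

/-- This serves the passage to the threshold `θ = 0`. The function chosen by `gaussHypergeometric`
is itself an analytic continuation, because one exists. -/
theorem continuousAt_interferenceFactor {α : ℝ} (hα : 2 < α) :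
    ContinuousAt (fun θ => interferenceFactor θ α) 0 := by
  have hα0 : 0 < α := by linarith
  have hb : 0 < 1 - 2 / α := by rw [sub_pos, div_lt_one hα0]; exact hα
  have hF := isHypergeometricContinuation_euler_integral hb
  have hG : IsHypergeometricContinuation 1 (1 - 2 / α) (2 - 2 / α)
      (gaussHypergeometric 1 (1 - 2 / α) (2 - 2 / α)) := by
    rw [show 2 - 2 / α = 1 - 2 / α + 1 by ring]
    exact Classical.epsilon_spec (p := IsHypergeometricContinuation 1 (1 - 2 / α) (1 - 2 / α + 1))
      ⟨_, hF⟩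
  have hc : ContinuousAt (gaussHypergeometric 1 (1 - 2 / α) (2 - 2 / α)) (-0 : ℝ) :=
    (hG.1 _ (by simp)).continuousAt
  unfold interferenceFactor
  exact ContinuousAt.mul (by fun_prop) (hc.comp (f := fun θ : ℝ => -θ) continuousAt_neg)

theorem interferenceFactor_nonneg {α θ : ℝ} (hα : 2 < α) (hθ : 0 ≤ θ) :
    0 ≤ interferenceFactor θ α := by
  rw [interferenceFactor_eq hα hθ]
  refine mul_nonneg (by positivity) (setIntegral_nonneg measurableSet_Ioc fun t ht => ?_)
  have := ht.1
  positivity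

/-- The substitution `v = t ^ (-(2 / α))` maps `(0, 1)` onto `(1, ∞)` and turns `v ^ (α / 2)` into
`t⁻¹`. Since `α > 2`, the exponent of `t` in Euler's integral exceeds `-1`. -/
theorem integral_Ioi_one_interference {α θ : ℝ} (hα : 2 < α) (hθ : 0 ≤ θ) :
    IntegrableOn (fun v : ℝ => θ / (θ + v ^ (α / 2))) (Ioi 1) ∧
      ∫ v in Ioi (1 : ℝ), θ / (θ + v ^ (α / 2)) = interferenceFactor θ α := by
  have hα0 : 0 < α := by linarith
  have hp : -(2 / α) ≠ 0 := by simp [hα0.ne']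
  have hb : 0 < 1 - 2 / α := by rw [sub_pos, div_lt_one hα0]; exact hα
  -- Extension by zero, since the change of variables acts on the whole half-line `Ioi 0`.
  let g : ℝ → ℝ := (Ioi 1).indicator fun v => θ / (θ + v ^ (α / 2))
  have hcongr : ∀ x ∈ Ioi (0 : ℝ), (|-(2 / α)| * x ^ (-(2 / α) - 1)) • g (x ^ (-(2 / α))) =
      (Ioo 0 1).indicator (fun t => 2 * θ / α * (t ^ (-(2 / α)) / (1 + θ * t))) x := by
    intro x hx
    have hx : 0 < x := hx
    have hlt : x ^ (-(2 / α)) ∈ Ioi (1 : ℝ) ↔ x ∈ Ioo (0 : ℝ) 1 := by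
      rw [mem_Ioi, Real.one_lt_rpow_iff_of_pos hx, mem_Ioo]
      have : -(2 / α) < 0 := by simp [hα0]
      constructor
      · rintro (⟨-, h⟩ | ⟨h, -⟩)
        · linarith
        · exact ⟨hx, h⟩
      · rintro ⟨-, h⟩; exact Or.inr ⟨h, this⟩
    by_cases h : x ∈ Ioo (0 : ℝ) 1
    · rw [indicator_of_mem h, show g (x ^ (-(2 / α))) = _ from indicator_of_mem (hlt.2 h) _,
        ← Real.rpow_mul hx.le, show -(2 / α) * (α / 2) = -1 by field_simp, Real.rpow_neg_one,
        Real.rpow_sub_one hx.ne', abs_neg, abs_of_pos (by positivity), smul_eq_mul]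
      have : 0 < 1 + θ * x := by positivity
      have : 0 < θ + x⁻¹ := by positivity
      field_simp
      ring
    · rw [indicator_of_notMem h, show g (x ^ (-(2 / α))) = _ from
        indicator_of_notMem (fun h' => h (hlt.1 h')) _, smul_zero]
  have hsub : Ioi (0 : ℝ) ∩ Ioo 0 1 = Ioo 0 1 := inter_eq_right.2 fun x hx => hx.1
  have hI1 : Ioi (0 : ℝ) ∩ Ioi 1 = Ioi 1 := inter_eq_right.2 fun x (hx : 1 < x) => mem_Ioi.2 (one_pos.trans hx)
  constructor
  · have : IntegrableOn g (Ioi 0) := by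
      rw [← integrableOn_Ioi_comp_rpow_iff g hp,
        integrableOn_congr_fun hcongr measurableSet_Ioi, IntegrableOn,
        integrable_indicator_iff measurableSet_Ioo, IntegrableOn, Measure.restrict_restrict
        measurableSet_Ioo, inter_comm, hsub]
      refine Integrable.const_mul ?_ _
      refine Integrable.mono' ((integrableOn_rpow_sub_one hb).mono_set Ioo_subset_Ioc_self)
        (by apply Measurable.aestronglyMeasurable; fun_prop) ?_
      filter_upwards [ae_restrict_mem measurableSet_Ioo] with t ht
      have ht0 := ht.1
      rw [Real.norm_of_nonneg (by positivity), show 1 - 2 / α - 1 = -(2 / α) by ring]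
      refine div_le_self (by positivity) ?_
      have : 0 ≤ θ * t := by positivity
      linarith
    rwa [IntegrableOn, integrable_indicator_iff measurableSet_Ioi, IntegrableOn,
      Measure.restrict_restrict measurableSet_Ioi, inter_comm, hI1] at this
  · have h1 := integral_comp_rpow_Ioi g hp
    rw [setIntegral_congr_fun measurableSet_Ioi hcongr, setIntegral_indicator measurableSet_Ioo,
      setIntegral_indicator measurableSet_Ioi, hsub, hI1] at h1
    rw [← h1, interferenceFactor_eq hα hθ, integral_const_mul, integral_Ioc_eq_integral_Ioo]

/-- The interference of a Poisson field beyond squared distance `r`. -/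
theorem lintegral_Ioi_interference {α θ : ℝ} (hα : 2 < α) (hθ : 0 ≤ θ) {r : ℝ} (hr : 0 < r) :
    ∫⁻ u in Ioi r, ENNReal.ofReal (θ / (θ + (u / r) ^ (α / 2))) =
      ENNReal.ofReal (r * interferenceFactor θ α) := by
  obtain ⟨h1, h2⟩ := integral_Ioi_one_interference hα hθ
  have hr' : 0 < r⁻¹ := inv_pos.2 hr
  have h3 : IntegrableOn (fun u : ℝ => θ / (θ + (r⁻¹ * u) ^ (α / 2))) (Ioi r) := by
    refine (integrableOn_Ioi_comp_mul_left_iff (fun v => θ / (θ + v ^ (α / 2))) r hr').2 ?_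
    rwa [inv_mul_cancel₀ hr.ne']
  have h4 := integral_comp_mul_left_Ioi (fun v => θ / (θ + v ^ (α / 2))) r hr'
  rw [inv_mul_cancel₀ hr.ne', h2, inv_inv, smul_eq_mul] at h4
  rw [← h4, ofReal_integral_eq_lintegral_ofReal h3]
  · simp only [div_eq_inv_mul _ r]
  · filter_upwards [ae_restrict_mem measurableSet_Ioi] with u hu
    have : 0 < u := hr.trans hu
    simp only [Pi.zero_apply]
    positivity

/-! ## Dyadic approximation of a real number from both sides -/

/-- The largest multiple of `2⁻ᵐ` that is at most `u`, for `u ≥ 0`. -/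
noncomputable def dyadicFloor (m : ℕ) (u : ℝ) : ℝ := ⌊u * 2 ^ m⌋₊ / 2 ^ m

/-- The least multiple of `2⁻ᵐ` that exceeds `u`, for `u ≥ 0`. -/
noncomputable def dyadicCeil (m : ℕ) (u : ℝ) : ℝ := (⌊u * 2 ^ m⌋₊ + 1) / 2 ^ m

theorem dyadicFloor_nonneg (m : ℕ) (u : ℝ) : 0 ≤ dyadicFloor m u := by
  unfold dyadicFloor; positivity

theorem dyadicFloor_le (m : ℕ) {u : ℝ} (hu : 0 ≤ u) : dyadicFloor m u ≤ u := by
  rw [dyadicFloor, div_le_iff₀ (by positivity)]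
  exact Nat.floor_le (by positivity)

theorem lt_dyadicCeil (m : ℕ) (u : ℝ) : u < dyadicCeil m u := by
  rw [dyadicCeil, lt_div_iff₀ (by positivity)]
  exact Nat.lt_floor_add_one _

theorem dyadicCeil_eq (m : ℕ) (u : ℝ) : dyadicCeil m u = dyadicFloor m u + (1 / 2) ^ m := by
  rw [dyadicCeil, dyadicFloor, add_div, one_div_pow]

theorem monotone_dyadicFloor {u : ℝ} (hu : 0 ≤ u) : Monotone fun m => dyadicFloor m u := by
  refine monotone_nat_of_le_succ fun m => ?_
  rw [dyadicFloor, dyadicFloor, div_le_div_iff₀ (by positivity) (by positivity), pow_succ]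
  have h : 2 * ⌊u * 2 ^ m⌋₊ ≤ ⌊u * (2 ^ m * 2)⌋₊ := by
    refine Nat.le_floor ?_
    push_cast
    have := Nat.floor_le (a := u * 2 ^ m) (by positivity)
    linarith
  have h' : (2 * ⌊u * 2 ^ m⌋₊ : ℝ) ≤ ⌊u * (2 ^ m * 2)⌋₊ := by exact_mod_cast h
  have := mul_le_mul_of_nonneg_right h' (by positivity : (0 : ℝ) ≤ 2 ^ m)
  linarith

theorem antitone_dyadicCeil {u : ℝ} (hu : 0 ≤ u) : Antitone fun m => dyadicCeil m u := by
  refine antitone_nat_of_succ_le fun m => ?_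
  rw [dyadicCeil, dyadicCeil, div_le_div_iff₀ (by positivity) (by positivity), pow_succ]
  have h : ⌊u * (2 ^ m * 2)⌋₊ < 2 * (⌊u * 2 ^ m⌋₊ + 1) := by
    rw [Nat.floor_lt (by positivity)]
    push_cast
    have := Nat.lt_floor_add_one (u * 2 ^ m)
    linarith
  have h' : (⌊u * (2 ^ m * 2)⌋₊ + 1 : ℝ) ≤ 2 * (⌊u * 2 ^ m⌋₊ + 1) := by exact_mod_cast h
  have := mul_le_mul_of_nonneg_right h' (by positivity : (0 : ℝ) ≤ 2 ^ m)
  linarith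

theorem tendsto_dyadicFloor {u : ℝ} (hu : 0 ≤ u) :
    Tendsto (fun m => dyadicFloor m u) atTop (𝓝 u) := by
  have h0 : Tendsto (fun m : ℕ => u - (1 / 2 : ℝ) ^ m) atTop (𝓝 (u - 0)) :=
    tendsto_const_nhds.sub
      (tendsto_pow_atTop_nhds_zero_of_lt_one (by norm_num) (by norm_num))
  rw [sub_zero] at h0
  refine tendsto_of_tendsto_of_tendsto_of_le_of_le h0 tendsto_const_nhds (fun m => ?_)
    fun m => dyadicFloor_le m hu
  have := lt_dyadicCeil m u
  rw [dyadicCeil_eq] at this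
  exact (sub_lt_iff_lt_add.2 this).le

theorem tendsto_dyadicCeil {u : ℝ} (hu : 0 ≤ u) :
    Tendsto (fun m => dyadicCeil m u) atTop (𝓝 u) := by
  simp_rw [dyadicCeil_eq]
  simpa using (tendsto_dyadicFloor hu).add
    (tendsto_pow_atTop_nhds_zero_of_lt_one (r := (1 / 2 : ℝ)) (by norm_num) (by norm_num))

/-! ## Interaction kernels and their dyadic approximations -/

section Kernel

variable {l : ℝ → ℝ → ℝ≥0∞}

/-- The kernel `l u v`, restricted to `u < v`. -/
noncomputable def upperKernel (l : ℝ → ℝ → ℝ≥0∞) (u v : ℝ) : ℝ≥0∞ := if u < v then l u v else 0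

/-- The approximation of `upperKernel l u v` from below that depends on `u` only through
`⌊u * 2 ^ m⌋₊`. -/
noncomputable def dyadicKernel (l : ℝ → ℝ → ℝ≥0∞) (m : ℕ) (u v : ℝ) : ℝ≥0∞ :=
  if dyadicCeil m u ≤ v then l (dyadicFloor m u) v else 0

theorem measurable_upperKernel (hl : ∀ u, Measurable (l u)) (u : ℝ) :
    Measurable (upperKernel l u) :=
  Measurable.ite measurableSet_Ioi (hl u) measurable_const

theorem measurable_dyadicKernel (hl : ∀ u, Measurable (l u)) (m : ℕ) (u : ℝ) :
    Measurable (dyadicKernel l m u) :=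
  Measurable.ite measurableSet_Ici (hl _) measurable_const

/-- Refining the mesh raises the floor, hence the value of `l`, and lowers the threshold, hence
enlarges the region where the kernel does not vanish. -/
theorem monotone_dyadicKernel (hmono : ∀ v, 0 < v → MonotoneOn (fun u => l u v) (Ici 0)) {u : ℝ}
    (hu : 0 ≤ u) (v : ℝ) : Monotone fun m => dyadicKernel l m u v := by
  intro m n hmn
  simp only [dyadicKernel]
  split_ifs with h1 h2
  · exact hmono v (hu.trans_lt ((lt_dyadicCeil m u).trans_le h1)) (dyadicFloor_nonneg m u)
      (dyadicFloor_nonneg n u) (monotone_dyadicFloor hu hmn)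
  · exact absurd ((antitone_dyadicCeil hu hmn).trans h1) h2
  · exact zero_le
  · exact le_rfl

theorem tendsto_dyadicKernel (hcont : ∀ v, 0 < v → ContinuousOn (fun u => l u v) (Ici 0)) {u : ℝ}
    (hu : 0 ≤ u) (v : ℝ) :
    Tendsto (fun m => dyadicKernel l m u v) atTop (𝓝 (upperKernel l u v)) := by
  rw [upperKernel]
  split_ifs with h
  · have h1 : Tendsto (fun m => l (dyadicFloor m u) v) atTop (𝓝 (l u v)) :=
      (hcont v (hu.trans_lt h) u hu).tendsto.comp (tendsto_nhdsWithin_iff.2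
        ⟨tendsto_dyadicFloor hu, Eventually.of_forall fun m => dyadicFloor_nonneg m u⟩)
    refine h1.congr' ?_
    filter_upwards [(tendsto_dyadicCeil hu).eventually (ge_mem_nhds h)] with m hm
    rw [dyadicKernel, if_pos hm]
  -- The ceiling lies strictly above `u`, so every approximation vanishes for `v ≤ u`; in particular
  -- the nearest point never interacts with itself.
  · refine tendsto_const_nhds.congr fun m => ?_
    rw [dyadicKernel, if_neg]
    exact fun hm => h ((lt_dyadicCeil m u).trans_le hm)

theorem dyadicKernel_congr {m : ℕ} {u u' : ℝ} (h : ⌊u * 2 ^ m⌋₊ = ⌊u' * 2 ^ m⌋₊) :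
    dyadicKernel l m u = dyadicKernel l m u' := by
  have h1 : dyadicFloor m u = dyadicFloor m u' := by rw [dyadicFloor, dyadicFloor, h]
  have h2 : dyadicCeil m u = dyadicCeil m u' := by rw [dyadicCeil, dyadicCeil, h]
  ext v
  rw [dyadicKernel, dyadicKernel, h1, h2]

theorem tendsto_lintegral_dyadicKernel (hl : ∀ u, Measurable (l u))
    (hmono : ∀ v, 0 < v → MonotoneOn (fun u => l u v) (Ici 0))
    (hcont : ∀ v, 0 < v → ContinuousOn (fun u => l u v) (Ici 0)) {u : ℝ} (hu : 0 ≤ u)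
    (ν : Measure ℝ) :
    Tendsto (fun m => ∫⁻ v, dyadicKernel l m u v ∂ν) atTop (𝓝 (∫⁻ v, upperKernel l u v ∂ν)) :=
  lintegral_tendsto_of_tendsto_of_monotone
    (fun m => (measurable_dyadicKernel hl m u).aemeasurable)
    (ae_of_all _ (monotone_dyadicKernel hmono hu)) (ae_of_all _ (tendsto_dyadicKernel hcont hu))

theorem tendsto_lintegral_one_sub_negExp_dyadicKernel (hl : ∀ u, Measurable (l u))
    (hmono : ∀ v, 0 < v → MonotoneOn (fun u => l u v) (Ici 0))
    (hcont : ∀ v, 0 < v → ContinuousOn (fun u => l u v) (Ici 0)) {u : ℝ} (hu : 0 ≤ u)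
    (ν : Measure ℝ) :
    Tendsto (fun m => ∫⁻ v, (1 - negExp (dyadicKernel l m u v)) ∂ν) atTop
      (𝓝 (∫⁻ v, (1 - negExp (upperKernel l u v)) ∂ν)) :=
  lintegral_tendsto_of_tendsto_of_monotone
    (fun m => (measurable_const.sub
      (measurable_negExp.comp (measurable_dyadicKernel hl m u))).aemeasurable)
    (ae_of_all _ fun v _ _ h =>
      tsub_le_tsub_left (negExp_antitone (monotone_dyadicKernel hmono hu v h)) 1)
    (ae_of_all _ fun v => ENNReal.Tendsto.sub tendsto_const_nhds
      ((continuous_negExp.tendsto _).comp (tendsto_dyadicKernel hcont hu v))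
      (Or.inl ENNReal.one_ne_top))

end Kernel

/-! ## The nearest point and the points beyond it -/

theorem lintegral_eq_tsum_fiber {A : Type*} [MeasurableSpace A] (ν : Measure A) {k : A → ℕ}
    (hk : Measurable k) (F : A → ℝ≥0∞) : ∫⁻ a, F a ∂ν = ∑' j, ∫⁻ a in k ⁻¹' {j}, F a ∂ν := by
  rw [← lintegral_iUnion (fun j => hk (measurableSet_singleton j))]
  · have : ⋃ j, k ⁻¹' {j} = univ := by ext; simp
    rw [this, setLIntegral_univ]
  · intro i j hij
    exact Disjoint.preimage _ (by simpa using hij)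

theorem lintegral_Ico_exp {c a b : ℝ} (hc : 0 < c) (hab : a ≤ b) :
    ∫⁻ u in Ico a b, ENNReal.ofReal (c * Real.exp (-(c * u))) =
      ENNReal.ofReal (Real.exp (-(c * a)) - Real.exp (-(c * b))) := by
  have hd : ∀ u, HasDerivAt (fun u => -Real.exp (-(c * u))) (c * Real.exp (-(c * u))) u := by
    intro u
    have h1 : HasDerivAt (fun u : ℝ => -(c * u)) (-(c * 1)) u :=
      ((hasDerivAt_id u).const_mul c).neg
    exact h1.exp.neg.congr_deriv (by ring)
  have hcont : Continuous fun u : ℝ => c * Real.exp (-(c * u)) := by fun_prop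
  rw [setLIntegral_congr Ico_ae_eq_Ioc, ← ofReal_integral_eq_lintegral_ofReal
    (hcont.integrableOn_Ioc) (ae_of_all _ fun u => by positivity),
    ← intervalIntegral.integral_of_le hab,
    intervalIntegral.integral_eq_sub_of_hasDerivAt (fun u _ => hd u) (hcont.intervalIntegrable _ _)]
  congr 1
  ring

section Nearest

variable {Ω κ : Type*} [MeasurableSpace Ω] {P : Measure Ω} {U : κ → Ω → ℝ}

theorem ciInf_eq_of_forall_le {x : κ → ℝ} {p : κ} (hp : ∀ q, x p ≤ x q) : ⨅ q, x q = x p := by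
  have : Nonempty κ := ⟨p⟩
  exact le_antisymm (ciInf_le ⟨x p, by rintro _ ⟨q, rfl⟩; exact hp q⟩ p) (le_ciInf hp)

/-- An infinite test function turns the Laplace functional into a restriction to the event that no
point lies below `a`. -/
theorem negExp_tsum_infinite_below {x : κ → ℝ} (hmin : ∃ p, ∀ q, x p ≤ x q) (a : ℝ) :
    negExp (∑' q, if x q < a then ∞ else 0) = if a ≤ ⨅ q, x q then 1 else 0 := by
  obtain ⟨p, hp⟩ := hmin
  rw [ciInf_eq_of_forall_le hp]
  split_ifs with h
  · have : ∀ q, (if x q < a then (∞ : ℝ≥0∞) else 0) = 0 := fun q =>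
      if_neg (not_lt.2 (h.trans (hp q)))
    simp [this]
  · rw [ENNReal.tsum_eq_top_of_eq_top ⟨p, if_pos (not_le.1 h)⟩, negExp_top]

theorem lintegral_le_iInf_negExp_tsum [Countable κ] (hU : ∀ p, Measurable (U p))
    (hmin : ∀ᵐ ω ∂P, ∃ p, ∀ q, U p ω ≤ U q ω) {c : ℝ≥0∞}
    (hL : ∀ ψ : ℝ → ℝ≥0∞, Measurable ψ → ∫⁻ ω, negExp (∑' p, ψ (U p ω)) ∂P =
      negExp (c * ∫⁻ u in Ici 0, (1 - negExp (ψ u))))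
    {a b : ℝ} (hab : a ≤ b) {K : ℝ → ℝ≥0∞} (hK : Measurable K)
    (hKb : ∀ v < b, K v = 0) :
    ∫⁻ ω in {ω | a ≤ ⨅ p, U p ω}, negExp (∑' p, K (U p ω)) ∂P =
      negExp (c * ENNReal.ofReal a) * negExp (c * ∫⁻ v in Ici 0, (1 - negExp (K v))) := by
  have hM : Measurable fun ω => ⨅ p, U p ω := Measurable.iInf hU
  have hψ : Measurable fun v => (if v < a then ∞ else 0) + K v :=
    (Measurable.ite measurableSet_Iio measurable_const measurable_const).add hK
  rw [← lintegral_indicator (measurableSet_le measurable_const hM)]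
  have h1 := hL _ hψ
  -- `K` vanishes where the infinite part lives, so the exponent splits into a void probability and
  -- the Laplace functional of `K`.
  have h2 : ∀ v, 1 - negExp ((if v < a then ∞ else 0) + K v) =
      (Iio a).indicator 1 v + (1 - negExp (K v)) := by
    intro v
    by_cases h : v < a
    · rw [if_pos h, hKb v (h.trans_le hab), indicator_of_mem (show v ∈ Iio a from h)]
      simp
    · rw [if_neg h, indicator_of_notMem (show v ∉ Iio a from h)]
      simp
  simp_rw [h2] at h1
  rw [lintegral_add_left (measurable_one.indicator measurableSet_Iio),
    lintegral_indicator_one measurableSet_Iio, Measure.restrict_apply measurableSet_Iio,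
    Iio_inter_Ici, Real.volume_Ico, sub_zero, mul_add, negExp_add] at h1
  rw [← h1]
  refine lintegral_congr_ae ?_
  filter_upwards [hmin] with ω h
  rw [ENNReal.tsum_add, negExp_add, negExp_tsum_infinite_below h]
  by_cases ha : a ≤ ⨅ p, U p ω
  · rw [indicator_of_mem (show ω ∈ {ω | a ≤ ⨅ p, U p ω} from ha), if_pos ha, one_mul]
  · rw [indicator_of_notMem (show ω ∉ {ω | a ≤ ⨅ p, U p ω} from ha), if_neg ha, zero_mul]

/-- The event is the difference of "no point below `a`" and "no point below `b`". As `K` vanishes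
below `b`, both carry the same Laplace factor, and `exp (-c a) - exp (-c b)` is the integral of the
exponential density. -/
theorem lintegral_cell_negExp_tsum [Countable κ] [IsProbabilityMeasure P]
    (hU : ∀ p, Measurable (U p)) (hmin : ∀ᵐ ω ∂P, ∃ p, ∀ q, U p ω ≤ U q ω) {c : ℝ} (hc : 0 < c)
    (hL : ∀ ψ : ℝ → ℝ≥0∞, Measurable ψ → ∫⁻ ω, negExp (∑' p, ψ (U p ω)) ∂P =
      negExp (ENNReal.ofReal c * ∫⁻ u in Ici 0, (1 - negExp (ψ u))))
    {a b : ℝ} (ha : 0 ≤ a) (hab : a ≤ b) {K : ℝ → ℝ≥0∞} (hK : Measurable K)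
    (hKb : ∀ v < b, K v = 0) :
    ∫⁻ ω in {ω | ⨅ p, U p ω ∈ Ico a b}, negExp (∑' p, K (U p ω)) ∂P =
      ∫⁻ u in Ico a b, ENNReal.ofReal (c * Real.exp (-(c * u))) *
        negExp (ENNReal.ofReal c * ∫⁻ v in Ici 0, (1 - negExp (K v))) := by
  have hM : Measurable fun ω => ⨅ p, U p ω := Measurable.iInf hU
  have hA := lintegral_le_iInf_negExp_tsum hU hmin hL hab hK hKb
  have hB := lintegral_le_iInf_negExp_tsum hU hmin hL le_rfl hK hKb
  have hu : {ω | a ≤ ⨅ p, U p ω} = {ω | ⨅ p, U p ω ∈ Ico a b} ∪ {ω | b ≤ ⨅ p, U p ω} := by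
    ext ω
    simp only [mem_ofPred_eq, mem_union, mem_Ico]
    constructor
    · intro h
      rcases lt_or_ge (⨅ p, U p ω) b with h' | h'
      · exact Or.inl ⟨h, h'⟩
      · exact Or.inr h'
    · rintro (h | h)
      · exact h.1
      · exact hab.trans h
  rw [hu, lintegral_union (measurableSet_le measurable_const hM)
    (Set.disjoint_left.2 fun ω h1 h2 => not_lt.2 h2 h1.2)] at hA
  have hfin : ∫⁻ ω in {ω | b ≤ ⨅ p, U p ω}, negExp (∑' p, K (U p ω)) ∂P ≠ ∞ := by
    rw [hB]; exact ENNReal.mul_ne_top (negExp_ne_top _) (negExp_ne_top _)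
  rw [ENNReal.eq_sub_of_add_eq hfin hA, hB, lintegral_mul_const _ (by fun_prop),
    lintegral_Ico_exp hc hab, ← ENNReal.ofReal_mul hc.le, ← ENNReal.ofReal_mul hc.le,
    negExp_ofReal (by positivity), negExp_ofReal (mul_nonneg hc.le (ha.trans hab)),
    ENNReal.ofReal_sub _ (Real.exp_pos _).le, ENNReal.sub_mul]
  exact fun _ _ => negExp_ne_top _

theorem lintegral_dyadicKernel [Countable κ] [Nonempty κ] [IsProbabilityMeasure P]
    (hU : ∀ p, Measurable (U p)) (h0 : ∀ p ω, 0 ≤ U p ω)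
    (hmin : ∀ᵐ ω ∂P, ∃ p, ∀ q, U p ω ≤ U q ω) {c : ℝ} (hc : 0 < c)
    (hL : ∀ ψ : ℝ → ℝ≥0∞, Measurable ψ → ∫⁻ ω, negExp (∑' p, ψ (U p ω)) ∂P =
      negExp (ENNReal.ofReal c * ∫⁻ u in Ici 0, (1 - negExp (ψ u))))
    {f : ℝ → ℝ≥0∞} {l : ℝ → ℝ → ℝ≥0∞} (hl : ∀ u, Measurable (l u)) (m : ℕ) :
    ∫⁻ ω, f (dyadicFloor m (⨅ p, U p ω)) *
        negExp (∑' q, dyadicKernel l m (⨅ p, U p ω) (U q ω)) ∂P =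
      ∫⁻ u in Ici 0, ENNReal.ofReal (c * Real.exp (-(c * u))) * (f (dyadicFloor m u) *
        negExp (ENNReal.ofReal c * ∫⁻ v in Ici 0, (1 - negExp (dyadicKernel l m u v)))) := by
  have hM : Measurable fun ω => ⨅ p, U p ω := Measurable.iInf hU
  have hk : Measurable fun u : ℝ => ⌊u * 2 ^ m⌋₊ := Nat.measurable_floor.comp (by fun_prop)
  have hcell : ∀ {u : ℝ} (j : ℕ), 0 ≤ u →
      (⌊u * 2 ^ m⌋₊ = j ↔ u ∈ Ico ((j : ℝ) / 2 ^ m) ((j + 1) / 2 ^ m)) := by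
    intro u j hu
    rw [Nat.floor_eq_iff (by positivity), mem_Ico, div_le_iff₀ (by positivity),
      lt_div_iff₀ (by positivity)]
  rw [lintegral_eq_tsum_fiber P (hk.comp hM), lintegral_eq_tsum_fiber (volume.restrict (Ici 0)) hk]
  refine tsum_congr fun j => ?_
  set a : ℝ := j / 2 ^ m with ha
  set b : ℝ := (j + 1) / 2 ^ m with hb
  have ha0 : 0 ≤ a := by positivity
  have hab : a ≤ b := by rw [ha, hb]; gcongr; linarith
  have hja : ⌊a * 2 ^ m⌋₊ = j := by
    rw [ha, div_mul_cancel₀ _ (by positivity), Nat.floor_natCast]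
  have hset1 : ((fun u : ℝ => ⌊u * 2 ^ m⌋₊) ∘ fun ω => ⨅ p, U p ω) ⁻¹' {j} =
      {ω | ⨅ p, U p ω ∈ Ico a b} := by
    ext ω
    exact hcell j (Real.iInf_nonneg fun p => h0 p ω)
  have hset2 : (fun u : ℝ => ⌊u * 2 ^ m⌋₊) ⁻¹' {j} ∩ Ici 0 = Ico a b := by
    ext u
    constructor
    · rintro ⟨h1, h2⟩; exact (hcell j h2).1 h1
    · intro h
      have hu := ha0.trans h.1
      exact ⟨(hcell j hu).2 h, hu⟩
  -- On a cell the floor and the kernel are frozen at the left end `a`, and the kernel only sees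
  -- points from the right end `b` on, as the cell formula requires.
  have hKb : ∀ v < b, dyadicKernel l m a v = 0 := fun v hv => by
    rw [dyadicKernel, if_neg]
    rw [dyadicCeil, hja]
    exact not_le.2 hv
  have hfloor : ∀ {u : ℝ}, u ∈ Ico a b → ⌊u * 2 ^ m⌋₊ = ⌊a * 2 ^ m⌋₊ := fun {u} hu => by
    rw [hja]; exact (hcell j (ha0.trans hu.1)).2 hu
  have hdf : ∀ {u : ℝ}, u ∈ Ico a b → dyadicFloor m u = dyadicFloor m a := fun hu => by
    rw [dyadicFloor, hfloor hu, dyadicFloor]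
  have hmeas1 : MeasurableSet {ω | ⨅ p, U p ω ∈ Ico a b} := hM measurableSet_Ico
  have hKm := measurable_dyadicKernel hl m a
  have hmeas2 : Measurable fun ω => negExp (∑' q, dyadicKernel l m a (U q ω)) :=
    measurable_negExp.comp (Measurable.tsum fun p => hKm.comp (hU p))
  rw [hset1, Measure.restrict_restrict (hk (measurableSet_singleton j)), hset2,
    setLIntegral_congr_fun hmeas1 (g := fun ω => f (dyadicFloor m a) *
      negExp (∑' q, dyadicKernel l m a (U q ω))) (fun ω hω => by
        simp only [hdf hω, dyadicKernel_congr (l := l) (hfloor hω)]),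
    setLIntegral_congr_fun measurableSet_Ico (g := fun u => f (dyadicFloor m a) *
      (ENNReal.ofReal (c * Real.exp (-(c * u))) *
        negExp (ENNReal.ofReal c * ∫⁻ v in Ici 0, (1 - negExp (dyadicKernel l m a v)))))
      (fun u hu => by
        simp only [hdf hu, dyadicKernel_congr (l := l) (hfloor hu)]
        ring),
    lintegral_const_mul _ hmeas2, lintegral_const_mul _ (by fun_prop),
    lintegral_cell_negExp_tsum hU hmin hc hL ha0 hab hKm hKb]

/-- The joint law of the squared distance to the nearest point of a Poisson process and of the
points beyond it. -/
theorem lintegral_nearest [Countable κ] [Nonempty κ] [IsProbabilityMeasure P]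
    (hU : ∀ p, Measurable (U p)) (h0 : ∀ p ω, 0 ≤ U p ω)
    (hmin : ∀ᵐ ω ∂P, ∃ p, ∀ q, U p ω ≤ U q ω) {c : ℝ} (hc : 0 < c)
    (hL : ∀ ψ : ℝ → ℝ≥0∞, Measurable ψ → ∫⁻ ω, negExp (∑' p, ψ (U p ω)) ∂P =
      negExp (ENNReal.ofReal c * ∫⁻ u in Ici 0, (1 - negExp (ψ u))))
    {f : ℝ → ℝ≥0∞} (hf : Continuous f) (hf1 : ∀ u, f u ≤ 1)
    {l : ℝ → ℝ → ℝ≥0∞} (hl : ∀ u, Measurable (l u))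
    (hmono : ∀ v, 0 < v → MonotoneOn (fun u => l u v) (Ici 0))
    (hcont : ∀ v, 0 < v → ContinuousOn (fun u => l u v) (Ici 0)) :
    ∫⁻ ω, f (⨅ p, U p ω) * negExp (∑' q, upperKernel l (⨅ p, U p ω) (U q ω)) ∂P =
      ∫⁻ u in Ici 0, ENNReal.ofReal (c * Real.exp (-(c * u))) * (f u *
        negExp (ENNReal.ofReal c * ∫⁻ v in Ici 0, (1 - negExp (upperKernel l u v)))) := by
  have hM : Measurable fun ω => ⨅ p, U p ω := Measurable.iInf hU
  have hk : ∀ m : ℕ, Measurable fun u : ℝ => ⌊u * 2 ^ m⌋₊ :=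
    fun m => Nat.measurable_floor.comp (by fun_prop)
  have hle : ∀ u t, f u * negExp t ≤ 1 := fun u t => mul_le_one' (hf1 u) (negExp_le_one t)
  have hne : ∀ u t, f u ≠ ∞ ∧ negExp t ≠ ∞ := fun u t =>
    ⟨((hf1 u).trans_lt ENNReal.one_lt_top).ne, negExp_ne_top t⟩
  have hlim1 : Tendsto (fun m => ∫⁻ ω, f (dyadicFloor m (⨅ p, U p ω)) *
      negExp (∑' q, dyadicKernel l m (⨅ p, U p ω) (U q ω)) ∂P) atTop
      (𝓝 (∫⁻ ω, f (⨅ p, U p ω) * negExp (∑' q, upperKernel l (⨅ p, U p ω) (U q ω)) ∂P)) := by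
    refine tendsto_lintegral_of_dominated_convergence (fun _ => 1) (fun m => ?_)
      (fun m => ae_of_all _ fun ω => hle _ _) (by simp) (ae_of_all _ fun ω => ?_)
    -- Joint measurability of `l` is not assumed. The integrand depends on the nearest distance
    -- through an integer only, so measurability for each integer suffices.
    · have h1 : Measurable fun x : ℕ × Ω => f ((x.1 : ℝ) / 2 ^ m) *
          negExp (∑' q, if ((x.1 : ℝ) + 1) / 2 ^ m ≤ U q x.2 then
            l ((x.1 : ℝ) / 2 ^ m) (U q x.2) else 0) := by
        refine measurable_from_prod_countable_right fun j => ?_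
        have h2 : Measurable fun ω => ∑' q, if ((j : ℝ) + 1) / 2 ^ m ≤ U q ω then
            l ((j : ℝ) / 2 ^ m) (U q ω) else 0 :=
          Measurable.tsum fun q => Measurable.ite (measurableSet_le measurable_const (hU q))
            ((hl _).comp (hU q)) measurable_const
        exact (measurable_negExp.comp h2).const_mul (f ((j : ℝ) / 2 ^ m))
      exact h1.comp (((hk m).comp hM).prodMk measurable_id)
    · have hu : 0 ≤ ⨅ p, U p ω := Real.iInf_nonneg fun p => h0 p ω
      refine ENNReal.Tendsto.mul ((hf.tendsto _).comp (tendsto_dyadicFloor hu))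
        (Or.inr (hne 0 _).2) ((continuous_negExp.tendsto _).comp ?_) (Or.inr (hne _ 0).1)
      rw [← lintegral_pointMeasure (fun q => U q ω) (measurable_upperKernel hl _)]
      simp_rw [← lintegral_pointMeasure (fun q => U q ω) (measurable_dyadicKernel hl _ _)]
      exact tendsto_lintegral_dyadicKernel hl hmono hcont hu _
  have hlim2 : Tendsto (fun m => ∫⁻ u in Ici 0, ENNReal.ofReal (c * Real.exp (-(c * u))) *
      (f (dyadicFloor m u) *
        negExp (ENNReal.ofReal c * ∫⁻ v in Ici 0, (1 - negExp (dyadicKernel l m u v))))) atTop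
      (𝓝 (∫⁻ u in Ici 0, ENNReal.ofReal (c * Real.exp (-(c * u))) * (f u *
        negExp (ENNReal.ofReal c * ∫⁻ v in Ici 0, (1 - negExp (upperKernel l u v)))))) := by
    refine tendsto_lintegral_of_dominated_convergence
      (fun u => ENNReal.ofReal (c * Real.exp (-(c * u)))) (fun m => ?_)
      (fun m => ae_of_all _ fun u => mul_le_of_le_one_right' (hle _ _)) ?_ ?_
    · refine Measurable.mul (by fun_prop) ?_
      have h1 : Measurable fun j : ℕ => f ((j : ℝ) / 2 ^ m) * negExp (ENNReal.ofReal c *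
          ∫⁻ v in Ici 0, (1 - negExp (if ((j : ℝ) + 1) / 2 ^ m ≤ v then
            l ((j : ℝ) / 2 ^ m) v else 0))) := .of_discrete
      exact h1.comp (hk m)
    · have h2 : IntegrableOn (fun u => c * Real.exp (-(c * u))) (Ici 0) := by
        rw [integrableOn_Ici_iff_integrableOn_Ioi]
        refine Integrable.const_mul ?_ c
        simpa only [neg_mul, IntegrableOn] using integrableOn_exp_mul_Ioi (neg_lt_zero.2 hc) 0
      exact h2.lintegral_lt_top.ne
    · filter_upwards [ae_restrict_mem measurableSet_Ici] with u hu
      refine ENNReal.Tendsto.const_mul ?_ (Or.inr ENNReal.ofReal_ne_top)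
      refine ENNReal.Tendsto.mul ((hf.tendsto _).comp (tendsto_dyadicFloor hu))
        (Or.inr (hne 0 _).2) ((continuous_negExp.tendsto _).comp ?_) (Or.inr (hne _ 0).1)
      exact ENNReal.Tendsto.const_mul
        (tendsto_lintegral_one_sub_negExp_dyadicKernel hl hmono hcont hu _)
        (Or.inr ENNReal.ofReal_ne_top)
  simp_rw [lintegral_dyadicKernel hU h0 hmin hc hL hl] at hlim1
  exact tendsto_nhds_unique hlim1 hlim2

end Nearest

/-! ## Exponential fading -/

theorem expMeasure_lt_ofReal (t : ℝ≥0∞) :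
    expMeasure 1 {x : ℝ | t < ENNReal.ofReal x} = negExp t := by
  have := isProbabilityMeasure_expMeasure one_pos
  induction t with
  | top => simp
  | coe t =>
    have hset : {x : ℝ | (t : ℝ≥0∞) < ENNReal.ofReal x} = (Iic (t : ℝ))ᶜ := by
      ext x
      simp only [mem_ofPred_eq, mem_compl_iff, mem_Iic, not_le]
      rw [← ENNReal.ofReal_coe_nnreal, ENNReal.ofReal_lt_ofReal_iff_of_nonneg t.coe_nonneg]
    have hcdf := cdf_expMeasure_eq one_pos (t : ℝ)
    rw [if_pos t.coe_nonneg, cdf_eq_real, one_mul] at hcdf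
    rw [hset, ← ofReal_measureReal, probReal_compl_eq_one_sub measurableSet_Iic, hcdf,
      ← ENNReal.ofReal_coe_nnreal, negExp_ofReal t.coe_nonneg, sub_sub_cancel]

/-- Tilting by `exp (-c x)` turns the density of rate `1` into `1 / (1 + c)` times that of rate `1 +
c`. The logarithm keeps the value in exponent form, so that infinite products become sums. -/
theorem lintegral_negExp_expMeasure {c : ℝ} (hc : 0 ≤ c) :
    ∫⁻ x, negExp (ENNReal.ofReal (c * x)) ∂(expMeasure 1) =
      negExp (ENNReal.ofReal (Real.log (1 + c))) := by
  have h1 : 0 < 1 + c := by linarith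
  have hpdf : Measurable (exponentialPDF 1) := (measurable_exponentialPDFReal 1).ennreal_ofReal
  have hpdf' : Measurable (exponentialPDF (1 + c)) :=
    (measurable_exponentialPDFReal (1 + c)).ennreal_ofReal
  have hexp : expMeasure 1 = volume.withDensity (exponentialPDF 1) := rfl
  rw [hexp, lintegral_withDensity_eq_lintegral_mul _ hpdf (by fun_prop)]
  have : ∀ x, (exponentialPDF 1 * fun x => negExp (ENNReal.ofReal (c * x))) x =
      ENNReal.ofReal (1 / (1 + c)) * exponentialPDF (1 + c) x := by
    intro x
    rw [Pi.mul_apply]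
    rcases lt_or_ge x 0 with hx | hx
    · rw [exponentialPDF_of_neg hx, exponentialPDF_of_neg hx, zero_mul, mul_zero]
    · rw [exponentialPDF_of_nonneg hx, exponentialPDF_of_nonneg hx,
        negExp_ofReal (mul_nonneg hc hx), ← ENNReal.ofReal_mul (by positivity),
        ← ENNReal.ofReal_mul (by positivity), one_mul, ← Real.exp_add, ← mul_assoc,
        one_div_mul_cancel h1.ne', one_mul]
      ring_nf
  simp_rw [this]
  rw [lintegral_const_mul _ hpdf', lintegral_exponentialPDF_eq_one h1, mul_one,
    negExp_ofReal (Real.log_nonneg (by linarith)), Real.exp_neg, Real.exp_log h1, one_div]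

section Fading

variable {Ω κ : Type*} [MeasurableSpace Ω] {P : Measure Ω} {h : κ → Ω → ℝ}

theorem lintegral_negExp_tsum_fading [IsProbabilityMeasure P] [Countable κ]
    (hh : ∀ p, Measurable (h p)) (hlaw : ∀ p, P.map (h p) = expMeasure 1) (hiid : iIndepFun h P)
    {c : κ → ℝ} (hc : ∀ p, 0 ≤ c p) :
    ∫⁻ ω, negExp (∑' p, ENNReal.ofReal (c p * h p ω)) ∂P =
      negExp (∑' p, ENNReal.ofReal (Real.log (1 + c p))) := by
  have hm : ∀ p, Measurable fun x : ℝ => negExp (ENNReal.ofReal (c p * x)) :=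
    fun p => by fun_prop
  have hfin : ∀ s : Finset κ, ∫⁻ ω, negExp (∑ p ∈ s, ENNReal.ofReal (c p * h p ω)) ∂P =
      negExp (∑ p ∈ s, ENNReal.ofReal (Real.log (1 + c p))) := by
    intro s
    simp_rw [negExp_sum]
    have h2 := lintegral_prod_eq_prod_lintegral_of_indepFun s _ (hiid.comp _ hm)
      fun p => (hm p).comp (hh p)
    simp only [Function.comp_apply] at h2
    rw [h2]
    refine Finset.prod_congr rfl fun p _ => ?_
    rw [← lintegral_negExp_expMeasure (hc p), ← hlaw p, lintegral_map (hm p) (hh p)]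
  have h1 : Tendsto (fun s : Finset κ => ∫⁻ ω, negExp (∑ p ∈ s, ENNReal.ofReal (c p * h p ω)) ∂P)
      atTop (𝓝 (∫⁻ ω, negExp (∑' p, ENNReal.ofReal (c p * h p ω)) ∂P)) := by
    refine tendsto_lintegral_filter_of_dominated_convergence (fun _ => 1)
      (Eventually.of_forall fun s => by fun_prop)
      (Eventually.of_forall fun s => ae_of_all _ fun ω => negExp_le_one _) (by simp)
      (ae_of_all _ fun ω => (continuous_negExp.tendsto _).comp ENNReal.summable.hasSum)
  have h2 : Tendsto (fun s : Finset κ => negExp (∑ p ∈ s, ENNReal.ofReal (Real.log (1 + c p))))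
      atTop (𝓝 (negExp (∑' p, ENNReal.ofReal (Real.log (1 + c p))))) :=
    (continuous_negExp.tendsto _).comp ENNReal.summable.hasSum
  simp_rw [hfin] at h1
  exact tendsto_nhds_unique h1 h2

/-- The probability that a unit mean exponential variable exceeds an independent one. -/
theorem measure_lt_ofReal_of_indepFun [IsProbabilityMeasure P] {J : Ω → ℝ≥0∞} (hJ : Measurable J)
    {g : Ω → ℝ} (hg : Measurable g) (hlaw : P.map g = expMeasure 1) (hind : IndepFun J g P) :
    P {ω | J ω < ENNReal.ofReal (g ω)} = ∫⁻ ω, negExp (J ω) ∂P := by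
  have := isProbabilityMeasure_expMeasure one_pos
  have hE : MeasurableSet {x : ℝ≥0∞ × ℝ | x.1 < ENNReal.ofReal x.2} :=
    measurableSet_lt measurable_fst (by fun_prop)
  have h1 : P {ω | J ω < ENNReal.ofReal (g ω)} =
      P.map (fun ω => (J ω, g ω)) {x : ℝ≥0∞ × ℝ | x.1 < ENNReal.ofReal x.2} := by
    rw [Measure.map_apply (hJ.prodMk hg) hE]; rfl
  rw [h1, (indepFun_iff_map_prod_eq_prod_map_map hJ.aemeasurable hg.aemeasurable).1 hind, hlaw,
    Measure.prod_apply hE, ← lintegral_map (f := negExp) measurable_negExp hJ]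
  exact lintegral_congr fun t => expMeasure_lt_ofReal t

/-- The sum is measurable for the σ-algebra of the fading variables other than `h p`. The function
`G` makes room for noise and scaling. -/
theorem indepFun_tsum_ne [Countable κ] (hh : ∀ p, Measurable (h p))
    (hiid : iIndepFun h P) (p : κ) {F : κ → ℝ → ℝ≥0∞} (hF : ∀ q, Measurable (F q)) (G : ℝ≥0∞ → ℝ≥0∞)
    (hG : Measurable G) : IndepFun (fun ω => G (∑' q : {q // q ≠ p}, F q (h q ω))) (h p) P := by
  have hind := indep_iSup_of_disjoint (m := fun q => MeasurableSpace.comap (h q) inferInstance)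
    (fun q => (hh q).comap_le) hiid.iIndep (S := {p}ᶜ) (T := {p}) disjoint_compl_left
  refine indep_of_indep_of_le hind ?_ ?_
  · have hpi : Measurable[⨆ q ∈ ({p}ᶜ : Set κ), MeasurableSpace.comap (h q) inferInstance]
        fun ω (q : {q // q ≠ p}) => h q ω :=
      @measurable_pi_lambda _ _ _
        (⨆ q ∈ ({p}ᶜ : Set κ), MeasurableSpace.comap (h q) inferInstance) _ _ fun q =>
          Measurable.of_comap_le
            (le_iSup₂_of_le (f := fun (q : κ) (_ : q ∈ ({p}ᶜ : Set κ)) =>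
              MeasurableSpace.comap (h q) inferInstance) (q : κ) q.2 le_rfl)
    have hsum : Measurable fun x : {q // q ≠ p} → ℝ => G (∑' q : {q // q ≠ p}, F q (x q)) :=
      hG.comp (Measurable.tsum fun q => (hF q).comp (measurable_pi_apply q))
    exact Measurable.comap_le (hsum.comp hpi)
  · exact le_iSup₂_of_le (f := fun (q : κ) (_ : q ∈ ({p} : Set κ)) =>
      MeasurableSpace.comap (h q) inferInstance) p rfl le_rfl

theorem lt_div_iff_scaled {θ g x : ℝ} (hθ : 0 < θ) (hg : 0 < g) {I : ℝ≥0∞} :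
    ENNReal.ofReal θ < ENNReal.ofReal (x * g) / I ↔
      ENNReal.ofReal (θ / g) * I < ENNReal.ofReal x := by
  have hg' : ENNReal.ofReal g ≠ 0 := by simpa using hg
  have h1 : ENNReal.ofReal θ < ENNReal.ofReal (x * g) / I ↔
      ENNReal.ofReal θ * I < ENNReal.ofReal (x * g) := by
    -- Infinite interference makes both sides false, and for the right-hand one this uses `θ > 0`.
    by_cases hI : I = ∞
    · rw [hI, ENNReal.div_top, ENNReal.mul_top (by simpa using hθ)]
      simp
    · exact ENNReal.lt_div_iff_mul_lt (Or.inr ENNReal.ofReal_ne_top) (Or.inl hI)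
  rw [h1, ENNReal.ofReal_mul' hg.le, show θ = θ / g * g by field_simp, ENNReal.ofReal_mul' hg.le,
    mul_right_comm, ENNReal.mul_lt_mul_iff_left hg' ENNReal.ofReal_ne_top, mul_div_cancel_right₀ _ hg.ne']

/-- The coverage probability for fixed locations of the transmitters. -/
theorem measure_coverage_fixed [IsProbabilityMeasure P] [Countable κ]
    (hh : ∀ p, Measurable (h p)) (hlaw : ∀ p, P.map (h p) = expMeasure 1) (hiid : iIndepFun h P)
    {g : κ → ℝ} (hg : ∀ q, 0 ≤ g q) {p : κ} (hp : 0 < g p) {θ η : ℝ} (hθ : 0 < θ) :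
    P {ω | ENNReal.ofReal θ < ENNReal.ofReal (h p ω * g p) /
        (ENNReal.ofReal η + ∑' q : {q // q ≠ p}, ENNReal.ofReal (h q ω * g q))} =
      negExp (ENNReal.ofReal (θ / g p * η)) *
        negExp (∑' q : {q // q ≠ p}, ENNReal.ofReal (Real.log (1 + θ / g p * g q))) := by
  have hs : 0 ≤ θ / g p := by positivity
  simp_rw [lt_div_iff_scaled hθ hp]
  have hF : ∀ q, Measurable fun x : ℝ => ENNReal.ofReal (x * g q) := fun q => by fun_prop
  have hind := indepFun_tsum_ne hh hiid p hF
    (fun t => ENNReal.ofReal (θ / g p) * (ENNReal.ofReal η + t)) (by fun_prop)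
  have hmeas : Measurable fun ω => ∑' q : {q // q ≠ p}, ENNReal.ofReal (h q ω * g q) :=
    Measurable.tsum fun q => (hF q).comp (hh q)
  rw [measure_lt_ofReal_of_indepFun (by fun_prop) (hh p) (hlaw p) hind]
  simp_rw [mul_add, negExp_add, ← ENNReal.tsum_mul_left, ← ENNReal.ofReal_mul hs]
  have hm2 : Measurable fun ω =>
      negExp (∑' q : {q // q ≠ p}, ENNReal.ofReal (θ / g p * (h q ω * g q))) :=
    measurable_negExp.comp (Measurable.tsum fun q =>
      (((hh q).mul_const _).const_mul _).ennreal_ofReal)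
  rw [lintegral_const_mul _ hm2, ← lintegral_negExp_tsum_fading (fun q : {q // q ≠ p} => hh q)
    (fun q => hlaw q) (hiid.precomp Subtype.val_injective)
    (fun q => mul_nonneg hs (hg q))]
  congr 1
  refine lintegral_congr fun ω => ?_
  congr 1
  exact tsum_congr fun q => by congr 1; ring

end Fading

/-- Fubini's theorem for the probability of an event that depends on two independent variables. -/
theorem ProbabilityTheory.IndepFun.measure_preimage_prodMk {Ω A B : Type*} [MeasurableSpace Ω]
    [MeasurableSpace A] [MeasurableSpace B] {P : Measure Ω} [IsProbabilityMeasure P] {f : Ω → A}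
    {g : Ω → B} (h : IndepFun f g P) (hf : Measurable f) (hg : Measurable g) {E : Set (A × B)}
    (hE : MeasurableSet E) :
    P {ω | (f ω, g ω) ∈ E} = ∫⁻ ω, P {ω' | (f ω, g ω') ∈ E} ∂P := by
  have := Measure.isProbabilityMeasure_map (μ := P) hg.aemeasurable
  have h1 : P {ω | (f ω, g ω) ∈ E} = P.map (fun ω => (f ω, g ω)) E := by
    rw [Measure.map_apply (hf.prodMk hg) hE]; rfl
  rw [h1, (indepFun_iff_map_prod_eq_prod_map_map hf.aemeasurable hg.aemeasurable).1 h,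
    Measure.prod_apply hE, lintegral_map (measurable_measure_prodMk_left hE) hf]
  refine lintegral_congr fun ω => ?_
  rw [Measure.map_apply hg (hE.preimage measurable_prodMk_left)]
  rfl

/-! ## Coverage in a Poisson network -/

/-- The logarithmic interaction between a serving transmitter at squared distance `u` and an
interfering one at squared distance `v`. -/
noncomputable def fadingKernel (θ α u v : ℝ) : ℝ≥0∞ :=
  ENNReal.ofReal (Real.log (1 + θ * (u / v) ^ (α / 2)))

theorem measurable_fadingKernel (θ α u : ℝ) : Measurable (fadingKernel θ α u) := by
  unfold fadingKernel
  fun_prop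

theorem monotoneOn_fadingKernel {θ α : ℝ} (hθ : 0 ≤ θ) (hα : 0 ≤ α) {v : ℝ} (hv : 0 < v) :
    MonotoneOn (fun u => fadingKernel θ α u v) (Ici 0) := by
  intro u hu u' _ huu'
  have hu : 0 ≤ u := hu
  simp only [fadingKernel]
  gcongr

theorem continuousOn_fadingKernel {θ α : ℝ} (hθ : 0 ≤ θ) (hα : 0 ≤ α) {v : ℝ} (hv : 0 < v) :
    ContinuousOn (fun u => fadingKernel θ α u v) (Ici 0) := by
  refine ENNReal.continuous_ofReal.comp_continuousOn (ContinuousOn.log ?_ fun u hu => ?_)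
  · refine continuousOn_const.add (continuousOn_const.mul ?_)
    exact ((continuous_id.div_const v).rpow_const fun u => Or.inr (by positivity)).continuousOn
  · have hu : 0 ≤ u := hu
    positivity

/-- With `x = (u / v) ^ (α / 2)` this is `1 - 1 / (1 + θ x) = θ / (θ + x⁻¹)`. -/
theorem one_sub_negExp_fadingKernel {θ α u v : ℝ} (hθ : 0 ≤ θ) (hu : 0 < u) (hv : 0 < v) :
    1 - negExp (fadingKernel θ α u v) = ENNReal.ofReal (θ / (θ + (v / u) ^ (α / 2))) := by
  have h1 : 0 < (u / v) ^ (α / 2) := by positivity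
  have h2 : 0 ≤ θ * (u / v) ^ (α / 2) := by positivity
  have h3 : (v / u) ^ (α / 2) = ((u / v) ^ (α / 2))⁻¹ := by
    rw [← Real.inv_rpow (by positivity), inv_div]
  rw [fadingKernel, negExp_ofReal (Real.log_nonneg (by linarith)), Real.exp_neg,
    Real.exp_log (by linarith), ← ENNReal.ofReal_one, ← ENNReal.ofReal_sub _ (by positivity), h3]
  congr 1
  field_simp
  ring

theorem lintegral_one_sub_negExp_fadingKernel {θ α u : ℝ} (hα : 2 < α) (hθ : 0 ≤ θ) (hu : 0 < u) :
    ∫⁻ v in Ici 0, (1 - negExp (upperKernel (fadingKernel θ α) u v)) =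
      ENNReal.ofReal (u * interferenceFactor θ α) := by
  rw [← lintegral_Ioi_interference hα hθ hu]
  have h1 : ∀ v, 1 - negExp (upperKernel (fadingKernel θ α) u v) =
      (Ioi u).indicator (fun v => ENNReal.ofReal (θ / (θ + (v / u) ^ (α / 2)))) v := by
    intro v
    by_cases h : u < v
    · rw [indicator_of_mem (show v ∈ Ioi u from h), upperKernel, if_pos h,
        one_sub_negExp_fadingKernel hθ hu (hu.trans h)]
    · rw [indicator_of_notMem (show v ∉ Ioi u from h), upperKernel, if_neg h]
      simp
  simp_rw [h1]
  rw [lintegral_indicator measurableSet_Ioi, Measure.restrict_restrict measurableSet_Ioi,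
    inter_eq_left.2 (show Ioi u ⊆ Ici 0 from fun v hv => hu.le.trans (le_of_lt hv))]

theorem pathLoss_eq (α : ℝ) (y x : Plane) : pathLoss α y x = (‖x - y‖ ^ 2) ^ (-(α / 2)) := by
  rw [pathLoss, ← Real.rpow_natCast, ← Real.rpow_mul (norm_nonneg _)]
  congr 1
  push_cast
  ring

/-- A strict minimum leaves the choice operator no freedom. -/
theorem serving_eq {Ω κ : Type*} [Nonempty κ] {X : κ → Ω → Plane} {y : Plane} {ω : Ω}
    {p : κ}
    (hp : ∀ q, q ≠ p → ‖X p ω - y‖ < ‖X q ω - y‖) : serving X y ω = p := by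
  have h1 : IsNearest X y ω p := fun q => by
    by_cases hq : q = p
    · rw [hq]
    · exact (hp q hq).le
  have h2 : IsNearest X y ω (serving X y ω) := Classical.epsilon_spec ⟨p, h1⟩
  by_contra hne
  exact not_lt.2 (h2 p) (hp _ hne)

theorem sinr_eq {Ω κ : Type*} [Nonempty κ] {X : κ → Ω → Plane} {h : κ → Ω → ℝ}
    {α W η : ℝ} {y : Plane} {ω : Ω} {p : κ}
    (hp : serving X y ω = p) :
    sinr α W η X h y ω = ENNReal.ofReal (h p ω * (‖X p ω - y‖ ^ 2) ^ (-(α / 2))) /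
      (ENNReal.ofReal (η * W) + ∑' q : {q // q ≠ p},
        ENNReal.ofReal (h q ω * (‖X q ω - y‖ ^ 2) ^ (-(α / 2)))) := by
  subst hp
  simp only [sinr, pathLoss_eq]

section Coverage

variable {Ω κ : Type*} [MeasurableSpace Ω] {P : Measure Ω} {X : κ → Ω → Plane} {h : κ → Ω → ℝ}

/-- A single point has area zero, so its count is Poisson with mean zero. This excludes distance
zero, where the power law takes a default value. -/
theorem IsPoissonPointProcess.ae_notMem [IsProbabilityMeasure P] {Φ : Ω → Set Plane} {lam : ℝ}
    (hΦ : IsPoissonPointProcess P Φ lam) (y : Plane) : ∀ᵐ ω ∂P, y ∉ Φ ω := by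
  have h1 := hΦ.poisson_count {y} (measurableSet_singleton y) Bornology.isBounded_singleton 0
  have h2 : P {ω | pointCount Φ {y} ω = (0 : ℕ)} = 1 := by
    have h0 : volume.real ({y} : Set Plane) = 0 := by simp [measureReal_def]
    rw [h1, h0]
    simp [poissonMeasure_singleton]
  have h3 : ∀ᵐ ω ∂P, pointCount Φ {y} ω = (0 : ℕ) :=
    (prob_compl_eq_zero_iff (hΦ.measurable_count _ (measurableSet_singleton y) _)).2 h2
  filter_upwards [h3] with ω hω hy
  rw [Nat.cast_zero, pointCount, encard_eq_zero] at hω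
  exact (hω ▸ (⟨hy, rfl⟩ : y ∈ Φ ω ∩ {y}) : y ∈ (∅ : Set Plane))

theorem IsPoissonPointProcess.ae_exists_nearest [IsProbabilityMeasure P] [Nonempty κ] {lam : ℝ}
    (hΦ : IsPoissonPointProcess P (fun ω => range (fun p => X p ω)) lam) {y : Plane}
    (hdist : ∀ᵐ ω ∂P, Function.Injective (fun p => ‖X p ω - y‖)) :
    ∀ᵐ ω ∂P, ∃ p, (∀ q, q ≠ p → ‖X p ω - y‖ < ‖X q ω - y‖) ∧ 0 < ‖X p ω - y‖ := by
  filter_upwards [hdist, hΦ.locallyFinite, hΦ.ae_notMem y] with ω h1 h2 h3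
  have hinj : Function.Injective (fun p => X p ω) := fun p q hpq =>
    h1 (congrArg (fun x => ‖x - y‖) hpq)
  obtain ⟨p, hp⟩ := exists_isNearest hinj h2 y
  refine ⟨p, fun q hq => lt_of_le_of_ne (hp q) fun he => hq (h1 he).symm, ?_⟩
  rw [norm_pos_iff, sub_ne_zero]
  exact fun he => h3 ⟨p, he⟩

/-- The pairs of squared distances and fading variables for which the nearest transmitter
provides coverage. -/
def coverageSet (κ : Type*) (α θ : ℝ) (w : ℝ≥0∞) : Set ((κ → ℝ) × (κ → ℝ)) :=
  ⋃ p, {z | (∀ q, q ≠ p → z.1 p < z.1 q) ∧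
    ENNReal.ofReal θ < ENNReal.ofReal (z.2 p * z.1 p ^ (-(α / 2))) /
      (w + ∑' q : {q // q ≠ p}, ENNReal.ofReal (z.2 q * z.1 q ^ (-(α / 2))))}

/-- The serving index is a choice, with no measurability attached. Ranging over all strict
minimisers describes coverage by countably many measurable conditions. -/
theorem measurableSet_coverageSet [Countable κ] (α θ : ℝ) (w : ℝ≥0∞) :
    MeasurableSet (coverageSet κ α θ w) := by
  refine MeasurableSet.iUnion fun p => ?_
  have h1 : MeasurableSet {z : (κ → ℝ) × (κ → ℝ) | ∀ q, q ≠ p → z.1 p < z.1 q} := by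
    have : {z : (κ → ℝ) × (κ → ℝ) | ∀ q, q ≠ p → z.1 p < z.1 q} =
        ⋂ q, ⋂ _ : q ≠ p, {z | z.1 p < z.1 q} := by ext; simp
    rw [this]
    exact MeasurableSet.iInter fun q => MeasurableSet.iInter fun _ =>
      measurableSet_lt (by fun_prop) (by fun_prop)
  have h2 : Measurable fun z : (κ → ℝ) × (κ → ℝ) =>
      ∑' q : {q // q ≠ p}, ENNReal.ofReal (z.2 q * z.1 q ^ (-(α / 2))) :=
    Measurable.tsum fun q => by fun_prop
  have h3 : MeasurableSet {z : (κ → ℝ) × (κ → ℝ) | ENNReal.ofReal θ <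
      ENNReal.ofReal (z.2 p * z.1 p ^ (-(α / 2))) /
        (w + ∑' q : {q // q ≠ p}, ENNReal.ofReal (z.2 q * z.1 q ^ (-(α / 2))))} :=
    measurableSet_lt measurable_const (by fun_prop)
  exact h1.inter h3

theorem mem_coverageSet_iff {α θ : ℝ} {w : ℝ≥0∞} {z : (κ → ℝ) × (κ → ℝ)} {p : κ}
    (hp : ∀ q, q ≠ p → z.1 p < z.1 q) : z ∈ coverageSet κ α θ w ↔
      ENNReal.ofReal θ < ENNReal.ofReal (z.2 p * z.1 p ^ (-(α / 2))) /
        (w + ∑' q : {q // q ≠ p}, ENNReal.ofReal (z.2 q * z.1 q ^ (-(α / 2)))) := by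
  simp only [coverageSet, mem_iUnion, mem_ofPred_eq]
  constructor
  · rintro ⟨p', h1, h2⟩
    have : p' = p := by
      by_contra hne
      exact lt_asymm (h1 p (Ne.symm hne)) (hp p' hne)
    subst this
    exact h2
  · exact fun h => ⟨p, hp, h⟩

theorem measure_coverageSet_fixed [Countable κ] [IsProbabilityMeasure P]
    (hh : ∀ p, Measurable (h p)) (hlaw : ∀ p, P.map (h p) = expMeasure 1) (hiid : iIndepFun h P)
    {α θ w : ℝ} (hθ : 0 < θ) {u : κ → ℝ} {p : κ} (hp : ∀ q, q ≠ p → u p < u q) (hpos : 0 < u p) :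
    P {ω | (u, fun p => h p ω) ∈ coverageSet κ α θ (ENNReal.ofReal w)} =
      negExp (ENNReal.ofReal (θ * (⨅ q, u q) ^ (α / 2) * w)) *
        negExp (∑' q, upperKernel (fadingKernel θ α) (⨅ q, u q) (u q)) := by
  have hle : ∀ q, u p ≤ u q := fun q => by
    by_cases hq : q = p
    · rw [hq]
    · exact (hp q hq).le
  have hu : ∀ q, 0 < u q := fun q => hpos.trans_le (hle q)
  have hset : {ω | (u, fun p => h p ω) ∈ coverageSet κ α θ (ENNReal.ofReal w)} =
      {ω | ENNReal.ofReal θ < ENNReal.ofReal (h p ω * u p ^ (-(α / 2))) /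
        (ENNReal.ofReal w + ∑' q : {q // q ≠ p}, ENNReal.ofReal (h q ω * u q ^ (-(α / 2))))} := by
    ext ω
    exact mem_coverageSet_iff (z := (u, fun p => h p ω)) hp
  have hg : θ / u p ^ (-(α / 2)) = θ * u p ^ (α / 2) := by
    rw [Real.rpow_neg hpos.le, div_inv_eq_mul]
  -- Since the minimum is strict, `q ≠ p` amounts to `u p < u q`; the sum over interferers becomes a
  -- sum over all points of the kernel restricted to larger distances.
  have hsum : ∑' q : {q // q ≠ p},
      ENNReal.ofReal (Real.log (1 + θ * u p ^ (α / 2) * u q ^ (-(α / 2)))) =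
        ∑' q, upperKernel (fadingKernel θ α) (u p) (u q) := by
    refine (tsum_subtype {q | q ≠ p}
      (fun q => ENNReal.ofReal (Real.log (1 + θ * u p ^ (α / 2) * u q ^ (-(α / 2)))))).trans ?_
    refine tsum_congr fun q => ?_
    by_cases hq : q = p
    · rw [indicator_of_notMem (by simpa using hq), upperKernel,
        if_neg (by rw [hq]; exact lt_irrefl _)]
    · rw [indicator_of_mem (show q ∈ {q | q ≠ p} from hq), upperKernel, if_pos (hp q hq),
        fadingKernel, Real.div_rpow hpos.le (hu q).le, Real.rpow_neg (hu q).le, mul_assoc,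
        ← div_eq_mul_inv]
  rw [hset, measure_coverage_fixed hh hlaw hiid (g := fun q => u q ^ (-(α / 2)))
    (fun q => (Real.rpow_pos_of_pos (hu q) _).le) (Real.rpow_pos_of_pos hpos _) hθ, hg, hsum,
    ciInf_eq_of_forall_le hle]

theorem measure_coverage [Countable κ] [Nonempty κ] [IsProbabilityMeasure P]
    (hX : ∀ p, Measurable (X p)) {lam : ℝ} (hlam : 0 < lam)
    (hΦ : IsPoissonPointProcess P (fun ω => range (fun p => X p ω)) lam) {y : Plane}
    (hdist : ∀ᵐ ω ∂P, Function.Injective (fun p => ‖X p ω - y‖))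
    (hh : ∀ p, Measurable (h p)) (hlaw : ∀ p, P.map (h p) = expMeasure 1) (hiid : iIndepFun h P)
    (hhX : IndepFun (fun ω p => h p ω) (fun ω p => X p ω) P)
    {α : ℝ} (hα : 2 < α) {W η : ℝ} {θ : ℝ} (hθ : 0 < θ) :
    P {ω | ENNReal.ofReal θ < sinr α W η X h y ω} =
      ∫⁻ u in Ioi 0, ENNReal.ofReal (lam * Real.pi * Real.exp (-(lam * Real.pi * u))) *
        (negExp (ENNReal.ofReal (θ * u ^ (α / 2) * (η * W))) *
          negExp (ENNReal.ofReal (lam * Real.pi) *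
            ENNReal.ofReal (u * interferenceFactor θ α))) := by
  have hα0 : 0 < α := by linarith
  have hc : 0 < lam * Real.pi := mul_pos hlam Real.pi_pos
  let U : κ → Ω → ℝ := fun p ω => ‖X p ω - y‖ ^ 2
  have hU : ∀ p, Measurable (U p) := fun p => by fun_prop
  have hnear : ∀ᵐ ω ∂P, ∃ p, (∀ q, q ≠ p → U p ω < U q ω) ∧ 0 < U p ω ∧ serving X y ω = p := by
    filter_upwards [hΦ.ae_exists_nearest hdist] with ω ⟨p, hp, hpos⟩
    exact ⟨p, fun q hq => pow_lt_pow_left₀ (hp q hq) (norm_nonneg _) two_ne_zero, by positivity,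
      serving_eq hp⟩
  have hmin : ∀ᵐ ω ∂P, ∃ p, ∀ q, U p ω ≤ U q ω := by
    filter_upwards [hnear] with ω ⟨p, hp, _, _⟩
    refine ⟨p, fun q => ?_⟩
    by_cases hq : q = p
    · rw [hq]
    · exact (hp q hq).le
  have hinj : ∀ᵐ ω ∂P, Function.Injective (fun p => X p ω) := by
    filter_upwards [hdist] with ω h1 p q hpq
    exact h1 (congrArg (fun x => ‖x - y‖) hpq)
  set w := ENNReal.ofReal (η * W) with hw
  have hcov : P {ω | ENNReal.ofReal θ < sinr α W η X h y ω} =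
      P {ω | ((fun p => U p ω), fun p => h p ω) ∈ coverageSet κ α θ w} := by
    refine measure_congr ?_
    filter_upwards [hnear] with ω ⟨p, hp, _, hs⟩
    have : (ENNReal.ofReal θ < sinr α W η X h y ω) =
        (((fun p => U p ω), fun p => h p ω) ∈ coverageSet κ α θ w) := by
      rw [mem_coverageSet_iff (p := p) hp, sinr_eq hs]
    exact this
  have hφ : Measurable fun (x : κ → Plane) (p : κ) => ‖x p - y‖ ^ 2 := by fun_prop
  have hind : IndepFun (fun ω p => U p ω) (fun ω p => h p ω) P :=
    (hhX.symm.comp hφ measurable_id :)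
  rw [hcov, hind.measure_preimage_prodMk (measurable_pi_lambda _ hU) (measurable_pi_lambda _ hh)
    (measurableSet_coverageSet α θ w)]
  -- Independence of fading and locations has reduced the event to frozen locations, for which the
  -- coverage probability is explicit.
  have hcond : ∫⁻ ω, P {ω' | ((fun p => U p ω), fun p => h p ω') ∈ coverageSet κ α θ w} ∂P =
      ∫⁻ ω, negExp (ENNReal.ofReal (θ * (⨅ p, U p ω) ^ (α / 2) * (η * W))) *
        negExp (∑' q, upperKernel (fadingKernel θ α) (⨅ p, U p ω) (U q ω)) ∂P := by
    refine lintegral_congr_ae ?_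
    filter_upwards [hnear] with ω ⟨p, hp, hpos, _⟩
    exact measure_coverageSet_fixed hh hlaw hiid hθ (u := fun q => U q ω) hp hpos
  have hf : Continuous fun u : ℝ => negExp (ENNReal.ofReal (θ * u ^ (α / 2) * (η * W))) :=
    continuous_negExp.comp (ENNReal.continuous_ofReal.comp
      ((continuous_const.mul (Real.continuous_rpow_const (by positivity))).mul continuous_const))
  have hmain := lintegral_nearest hU (fun p ω => by positivity) hmin hc
    (fun ψ hψ => laplace_functional_sq_dist hX hinj hlam.le hΦ y hψ) hf
    (fun u => negExp_le_one _) (l := fadingKernel θ α) (measurable_fadingKernel θ α)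
    (fun v hv => monotoneOn_fadingKernel hθ.le hα0.le hv)
    (fun v hv => continuousOn_fadingKernel hθ.le hα0.le hv)
  -- The null point `u = 0` is removed, because the interference integral is evaluated for `u > 0`
  -- only.
  rw [hcond, hmain, setLIntegral_congr Ioi_ae_eq_Ici.symm]
  refine setLIntegral_congr_fun measurableSet_Ioi fun u hu => ?_
  simp only [lintegral_one_sub_negExp_fadingKernel hα hθ.le hu]

/-! ### Integrability of the coverage formula and the threshold zero -/

/-- The integrand of the coverage probability. -/
noncomputable def coverageDensity (α θ w lam r : ℝ) : ℝ :=
  Real.exp (-(θ * r ^ (α / 2) * w)) *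
    Real.exp (-(Real.pi * r * (1 + interferenceFactor θ α) * lam))

@[fun_prop] theorem measurable_coverageDensity (α θ w lam : ℝ) :
    Measurable (coverageDensity α θ w lam) := by
  unfold coverageDensity
  fun_prop

theorem coverageDensity_nonneg (α θ w lam r : ℝ) : 0 ≤ coverageDensity α θ w lam r := by
  unfold coverageDensity
  positivity

/-- The bound does not involve `θ`, so it also dominates the limit of vanishing thresholds. -/
theorem coverageDensity_le {α θ w lam r : ℝ} (hα : 2 < α) (hθ : 0 ≤ θ) (hw : 0 ≤ w)
    (hlam : 0 ≤ lam) (hr : 0 < r) :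
    coverageDensity α θ w lam r ≤ Real.exp (-(Real.pi * lam) * r) := by
  have hZ := interferenceFactor_nonneg hα hθ
  have h1 : 0 ≤ θ * r ^ (α / 2) * w := by positivity
  have h2 : 0 ≤ Real.pi * r * interferenceFactor θ α * lam := by positivity
  rw [coverageDensity, ← Real.exp_add]
  refine Real.exp_le_exp.2 ?_
  linarith

theorem integrableOn_exp_bound {lam : ℝ} (hlam : 0 < lam) :
    IntegrableOn (fun r => Real.exp (-(Real.pi * lam) * r)) (Ioi 0) :=
  integrableOn_exp_mul_Ioi (neg_lt_zero.2 (mul_pos Real.pi_pos hlam)) 0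

theorem integrableOn_coverageDensity {α θ w lam : ℝ} (hα : 2 < α) (hθ : 0 ≤ θ) (hw : 0 ≤ w)
    (hlam : 0 < lam) : IntegrableOn (coverageDensity α θ w lam) (Ioi 0) := by
  refine Integrable.mono' (integrableOn_exp_bound hlam)
    (measurable_coverageDensity α θ w lam).aestronglyMeasurable ?_
  filter_upwards [ae_restrict_mem measurableSet_Ioi] with r hr
  rw [Real.norm_of_nonneg (coverageDensity_nonneg _ _ _ _ _)]
  exact coverageDensity_le hα hθ hw hlam.le hr

theorem tendsto_integral_coverageDensity {α w lam : ℝ} (hα : 2 < α) (hw : 0 ≤ w) (hlam : 0 < lam)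
    {t : ℕ → ℝ} (ht0 : ∀ n, 0 ≤ t n) (ht : Tendsto t atTop (𝓝 0)) :
    Tendsto (fun n => ∫ r in Ioi (0 : ℝ), coverageDensity α (t n) w lam r) atTop
      (𝓝 (∫ r in Ioi (0 : ℝ), coverageDensity α 0 w lam r)) := by
  refine tendsto_integral_of_dominated_convergence _
    (fun n => (measurable_coverageDensity α (t n) w lam).aestronglyMeasurable)
    (integrableOn_exp_bound hlam) (fun n => ?_) (ae_of_all _ fun r => ?_)
  · filter_upwards [ae_restrict_mem measurableSet_Ioi] with r hr
    rw [Real.norm_of_nonneg (coverageDensity_nonneg _ _ _ _ _)]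
    exact coverageDensity_le hα (ht0 n) hw hlam.le hr
  · have hc : ContinuousAt (fun θ => coverageDensity α θ w lam r) 0 := by
      have := continuousAt_interferenceFactor hα
      unfold coverageDensity
      fun_prop
    exact hc.tendsto.comp ht

theorem measureReal_coverage [Countable κ] [Nonempty κ] [IsProbabilityMeasure P]
    (hX : ∀ p, Measurable (X p)) {lam : ℝ} (hlam : 0 < lam)
    (hΦ : IsPoissonPointProcess P (fun ω => range (fun p => X p ω)) lam) {y : Plane}
    (hdist : ∀ᵐ ω ∂P, Function.Injective (fun p => ‖X p ω - y‖))
    (hh : ∀ p, Measurable (h p)) (hlaw : ∀ p, P.map (h p) = expMeasure 1) (hiid : iIndepFun h P)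
    (hhX : IndepFun (fun ω p => h p ω) (fun ω p => X p ω) P)
    {α : ℝ} (hα : 2 < α) {W η : ℝ} (hW : 0 ≤ η * W) {θ : ℝ} (hθ : 0 ≤ θ) :
    P.real {ω | ENNReal.ofReal θ < sinr α W η X h y ω} =
      Real.pi * lam * ∫ r in Ioi (0 : ℝ), coverageDensity α θ (η * W) lam r := by
  have hpos : ∀ θ, 0 < θ → P.real {ω | ENNReal.ofReal θ < sinr α W η X h y ω} =
      Real.pi * lam * ∫ r in Ioi (0 : ℝ), coverageDensity α θ (η * W) lam r := by
    intro θ hθ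
    have hc : 0 < lam * Real.pi := mul_pos hlam Real.pi_pos
    rw [← integral_const_mul, integral_eq_lintegral_of_nonneg_ae
      (ae_of_all _ fun r => mul_nonneg (by positivity) (coverageDensity_nonneg _ _ _ _ _))
      (by fun_prop), measureReal_def, measure_coverage hX hlam hΦ hdist hh hlaw hiid hhX hα hθ]
    congr 1
    refine setLIntegral_congr_fun measurableSet_Ioi fun u hu => ?_
    have hu : 0 < u := hu
    have hZ := interferenceFactor_nonneg hα hθ.le
    rw [← ENNReal.ofReal_mul hc.le, negExp_ofReal (by positivity), negExp_ofReal (by positivity),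
      ← ENNReal.ofReal_mul (Real.exp_pos _).le, ← ENNReal.ofReal_mul (by positivity),
      coverageDensity]
    congr 1
    rw [mul_assoc (lam * Real.pi), mul_left_comm (Real.exp _) (Real.exp _) (Real.exp _),
      ← Real.exp_add (-(lam * Real.pi * u)), mul_comm lam]
    congr 3
    ring
  -- At `θ = 0` clearing the denominator fails if the interference is infinite. Instead, positive
  -- SINR is the increasing union of the events for the thresholds `1 / (n + 1)`, and both sides
  -- pass to the limit.
  rcases hθ.eq_or_lt with rfl | hθ
  · let t : ℕ → ℝ := fun n => 1 / ((n : ℝ) + 1)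
    have ht0 : ∀ n, 0 < t n := fun n => by positivity
    have ht : Tendsto t atTop (𝓝 0) := tendsto_one_div_add_atTop_nhds_zero_nat
    have hanti : Antitone t := fun m n hmn => by
      simp only [t]; gcongr
    have hmono : Monotone fun n => {ω | ENNReal.ofReal (t n) < sinr α W η X h y ω} :=
      fun m n hmn ω hω => (ENNReal.ofReal_le_ofReal (hanti hmn)).trans_lt hω
    have hunion : ⋃ n, {ω | ENNReal.ofReal (t n) < sinr α W η X h y ω} =
        {ω | ENNReal.ofReal 0 < sinr α W η X h y ω} := by
      ext ω
      simp only [mem_iUnion, mem_ofPred_eq, ENNReal.ofReal_zero]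
      constructor
      · rintro ⟨n, hn⟩; exact zero_le.trans_lt hn
      · intro hω
        have h1 : Tendsto (fun n => ENNReal.ofReal (t n)) atTop (𝓝 0) := by
          simpa using ENNReal.tendsto_ofReal ht
        exact (h1.eventually (gt_mem_nhds hω)).exists
    have h1 : Tendsto (fun n => P.real {ω | ENNReal.ofReal (t n) < sinr α W η X h y ω}) atTop
        (𝓝 (P.real {ω | ENNReal.ofReal 0 < sinr α W η X h y ω})) := by
      rw [← hunion]
      exact (ENNReal.tendsto_toReal (measure_ne_top _ _)).comp
        (tendsto_measure_iUnion_atTop hmono)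
    have h2 := (tendsto_integral_coverageDensity hα hW hlam (fun n => (ht0 n).le) ht).const_mul
      (Real.pi * lam)
    simp_rw [hpos _ (ht0 _)] at h1
    exact tendsto_nhds_unique h1 h2
  · exact hpos θ hθ

end Coverage

/-! ### The full sharing scenario -/

theorem proposition4
    {Ω : Type*} [MeasurableSpace Ω] (P : Measure Ω) [IsProbabilityMeasure P]
    -- the finite set of operators (and of their spectrum bands), and the user's operator `n`
    {N : Type*} [Fintype N] [Nonempty N] (n : N)
    -- intensities, path loss exponent, noise power, reception threshold
    (lam : N → ℝ) (hlam : ∀ i, 0 < lam i)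
    (α : ℝ) (hα : 2 < α) (W : ℝ) (hW : 0 ≤ W) (θ : ℝ) (hθ : 0 ≤ θ)
    -- `X (i, j)` is the location of the `j`-th transmitter of operator `i`
    (X : N × ℕ → Ω → Plane) (hX : ∀ p, Measurable (X p))
    (hXinj : ∀ i, ∀ᵐ ω ∂P, Function.Injective (fun j : ℕ => X (i, j) ω))
    -- the operators' sets of transmitters are independent Poisson point processes
    (Φ : N → Ω → Set Plane) (hΦ : ∀ i ω, Φ i ω = range (fun j : ℕ => X (i, j) ω))
    (hPoisson : ∀ i, IsPoissonPointProcess P (Φ i) (lam i))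
    (hindep : iIndep (fun i => pointSigmaAlgebra (Φ i)) P)
    -- `h k p` is the power fading of transmitter `p` in band `k`: exponential with unit mean,
    -- independent over the transmitters and independent of the locations
    (h : N → N × ℕ → Ω → ℝ) (hh : ∀ k p, Measurable (h k p))
    (hlaw : ∀ k p, P.map (h k p) = expMeasure 1)
    (hiid : ∀ k, iIndepFun (h k) P)
    (hhX : ∀ k, IndepFun (fun ω p => h k p ω) (fun ω p => X p ω) P)
    -- flat fading: the fading is the same in all the bands
    (hflat : ∀ k k' p, h k p =ᵐ[P] h k' p)
    -- the locations of the operators' reference users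
    (y : N → Plane) :
    -- the shared network is a Poisson point process with the summed intensity
    IsPoissonPointProcess P (fun ω => ⋃ i, Φ i ω) (∑ i, lam i) ∧
    -- the user of operator `n` has almost surely exactly one nearest transmitter in it
    (∀ᵐ ω ∂P, ∃! p, IsNearest X (y n) ω p) ∧
    IntegrableOn (fun r : ℝ =>
      Real.exp (-(θ * r ^ (α / 2) * (Fintype.card N * W))) *
        Real.exp (-(Real.pi * r * (1 + interferenceFactor θ α) * ∑ j, lam j))) (Ioi 0) ∧
    -- the probability of coverage in all the shared bands
    P.real {ω | ∀ k, ENNReal.ofReal θ < sinr α W (Fintype.card N) X (h k) (y n) ω} =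
      Real.pi * (∑ i, lam i) * ∫ r in Ioi (0 : ℝ),
        Real.exp (-(θ * r ^ (α / 2) * (Fintype.card N * W))) *
          Real.exp (-(Real.pi * r * (1 + interferenceFactor θ α) * ∑ j, lam j)) ∧
    -- the probability of coverage in each shared band
    ∀ k, P.real {ω | ENNReal.ofReal θ < sinr α W (Fintype.card N) X (h k) (y n) ω} =
      Real.pi * (∑ i, lam i) * ∫ r in Ioi (0 : ℝ),
        Real.exp (-(θ * r ^ (α / 2) * (Fintype.card N * W))) *
          Real.exp (-(Real.pi * r * (1 + interferenceFactor θ α) * ∑ j, lam j)) := by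
  have hlam' : 0 < ∑ i, lam i := Finset.sum_pos (fun i _ => hlam i) Finset.univ_nonempty
  have hdist := fun y => ae_injective_norm_sub hlam hXinj hΦ hPoisson hindep y
  -- Distinct distances from one fixed centre, here the origin, already force all locations to be
  -- distinct, across operators too.
  have hinj : ∀ᵐ ω ∂P, Function.Injective (fun p => X p ω) := by
    filter_upwards [hdist 0] with ω h1 p q hpq
    exact h1 (congrArg (fun x => ‖x - 0‖) hpq)
  have hU := isPoissonPointProcess_iUnion hlam hX hΦ hinj hPoisson hindep
  have hR : IsPoissonPointProcess P (fun ω => range (fun p => X p ω)) (∑ i, lam i) := by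
    simpa only [iUnion_eq_range hΦ] using hU
  have hW' : 0 ≤ (Fintype.card N : ℝ) * W := by positivity
  have hcov : ∀ k, P.real {ω | ENNReal.ofReal θ <
      sinr α W (Fintype.card N) X (h k) (y n) ω} = Real.pi * (∑ i, lam i) *
        ∫ r in Ioi (0 : ℝ), coverageDensity α θ (Fintype.card N * W) (∑ i, lam i) r :=
    fun k => measureReal_coverage hX hlam' hR (hdist (y n)) (hh k) (hlaw k) (hiid k) (hhX k) hα
      hW' hθ
  refine ⟨hU, ?_, integrableOn_coverageDensity hα hθ hW' hlam', ?_, hcov⟩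
  · filter_upwards [hR.ae_exists_nearest (hdist (y n))] with ω ⟨p, hp, _⟩
    refine ⟨p, fun q => ?_, fun q hq => ?_⟩
    · by_cases hqp : q = p
      · rw [hqp]
      · exact (hp q hqp).le
    · by_contra hne
      exact not_lt.2 (hq p) (hp q hne)
  -- Bands and transmitters are countable, so off one null set the fading agrees in all bands; the
  -- intersection of the coverage events is then the event for band `n`.
  · refine Eq.trans ?_ (hcov n)
    refine measureReal_congr ?_
    filter_upwards [ae_all_iff.2 fun k => ae_all_iff.2 fun p => hflat k n p] with ω hω
    have hs : ∀ k, sinr α W (Fintype.card N) X (h k) (y n) ω =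
        sinr α W (Fintype.card N) X (h n) (y n) ω := fun k => by
      simp only [sinr, hω k]
    have : (∀ k, ENNReal.ofReal θ < sinr α W (Fintype.card N) X (h k) (y n) ω) =
        (ENNReal.ofReal θ < sinr α W (Fintype.card N) X (h n) (y n) ω) := by
      simp only [hs, forall_const]
    exact this
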